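/- **Theorem 1.2.** There is an absolute constant $C$ such that for all integers $\Delta\ge 5$ and $n\ge 1$ and every real $0<\epsilon<1$ there are a non-negative integer $$K\ \le\ e^{C\Delta}\,\ln(n/\epsilon)$$ and a polynomial $Q=Q_{\Delta,n,\epsilon}$ in $K$ variables, with rational coefficients and $\deg Q\le K$, for which the following holds. Let $\Omega_1,\dots,\Omega_m$ be probability spaces, let $\Omega=\Omega_1\times\cdots\times\Omega_m$ be their product with the product measure $\mathbf P$, and let $A_1,\dots,A_n\subset\Omega$ be events. The set of coordinates that an event $A$ depends on is the smallest set $J\subset\{1,\dots,m\}$ such that membership of a point $x\in\Omega$ in $A$ is determined by the coordinates of $x$ with indices in $J$; two events share a coordinate if these sets intersect. Let $r_i,\Delta_i\ge 0$ be integers such that, for $i=1,\dots,n$, the event $A_i$ depends on at most $r_i$ coordinates and at most $\Delta_i$ of the events $A_j$ with $j\ne i$ share a coordinate with $A_i$. Suppose that $$\Delta=\max\{5,\ \Delta_1,\dots,\Delta_n\},\qquad \mu_i=\min\{r_i,\ \Delta_i+1\},\qquad \mathbf P(A_i)<(3\Delta)^{-3\mu_i}\quad\text{for } i=1,\dots,n,$$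 and put $$p=\mathbf P\Bigl(\bigcap_{i=1}^n\overline{A_i}\Bigr),\qquad \sigma_k=\sum_{1\le i_1<\cdots<i_k\le n}\mathbf P\bigl(A_{i_1}\cap\cdots\cap A_{i_k}\bigr)\quad (1\le k\le K),$$ where $\overline{A_i}$ is the complement of $A_i$ and $\sigma_k=0$ if $k>n$. Then $p>0$, $$\bigl|\ln p-Q(\sigma_1,\dots,\sigma_K)\bigr|\le\epsilon ,$$ and $p$ is determined by $\sigma_1,\dots,\sigma_K$ up to relative error $\epsilon$, namely $$\bigl|e^{Q(\sigma_1,\dots,\sigma_K)}-p\bigr|\le\epsilon\,p .$$ -/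

import Mathlib

open MeasureTheory

universe u

/-- The set `J_f` of coordinates that a function `f` on a product depends on: the intersection of
all sets `J` of coordinates such that `f x = f y` whenever `x` and `y` agree on `J`
(Mathlib's `DependsOn f J`). For finitely many coordinates it is the unique minimal such `J`, see
`minimal_dependsOn_iff`. -/
def coordSet {ι : Type*} {Ω : ι → Type*} {β : Type*} (f : (∀ j, Ω j) → β) : Set ι :=
  ⋂₀ {J : Set ι | DependsOn f J}

theorem dependsOn_inter {ι : Type*} {Ω : ι → Type*} {β : Type*} {f : (∀ j, Ω j) → β}
    {J J' : Set ι} (h : DependsOn f J) (h' : DependsOn f J') : DependsOn f (J ∩ J') := by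
  classical
  intro x y hxy
  have h1 : f x = f (fun j => if j ∈ J then x j else y j) :=
    h (fun j hj => by simp [hj])
  have h2 : f (fun j => if j ∈ J then x j else y j) = f y := by
    refine h' (fun j hj => ?_)
    by_cases hJ : j ∈ J
    · simpa [hJ] using hxy j ⟨hJ, hj⟩
    · simp [hJ]
  exact h1.trans h2

theorem dependsOn_coordSet {ι : Type*} [Finite ι] {Ω : ι → Type*} {β : Type*}
    (f : (∀ j, Ω j) → β) : DependsOn f (coordSet f) := by
  have key : ∀ s : Set (Set ι), s.Finite → (∀ J ∈ s, DependsOn f J) → DependsOn f (⋂₀ s) := by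
    intro s hs
    induction s, hs using Set.Finite.induction_on with
    | empty => intro _; simpa using dependsOn_univ f
    | insert _ _ ih =>
      intro h
      rw [Set.sInter_insert]
      exact dependsOn_inter (h _ (Set.mem_insert _ _))
        (ih fun J hJ => h J (Set.mem_insert_of_mem _ hJ))
  exact key _ (Set.toFinite _) fun _ hJ => hJ

/-- `coordSet f` is the one and only minimal set of coordinates that determines `f`. -/
theorem minimal_dependsOn_iff {ι : Type*} [Finite ι] {Ω : ι → Type*} {β : Type*}
    (f : (∀ j, Ω j) → β) (J : Set ι) : Minimal (DependsOn f) J ↔ J = coordSet f := by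
  have hle : ∀ J' : Set ι, DependsOn f J' → coordSet f ≤ J' := fun J' h => Set.sInter_subset_of_mem h
  constructor
  · intro h
    exact le_antisymm (h.2 (dependsOn_coordSet f) (hle J h.1)) (hle J h.1)
  · rintro rfl
    exact ⟨dependsOn_coordSet f, fun J' h _ => hle J' h⟩

/-- The set of coordinates that an event `A` depends on, i.e. that its indicator depends on. -/
noncomputable def eventCoords {m : ℕ} {Ω : Fin m → Type*} (A : Set (∀ j, Ω j)) : Set (Fin m) :=
  coordSet (A.indicator (fun _ => (1 : ℂ)))

/-- Two events share a coordinate. -/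
def ShareCoordinate {m : ℕ} {Ω : Fin m → Type*} (A B : Set (∀ j, Ω j)) : Prop :=
  (eventCoords A ∩ eventCoords B).Nonempty

/-- `σ_k`: the sum of the probabilities of the intersections `A_{i₁} ∩ ⋯ ∩ A_{i_k}` over all
`i₁ < ⋯ < i_k`, that is, over all `k`-element sets of indices. -/
noncomputable def intersectionSum {X : Type*} [MeasurableSpace X] (P : Measure X) {n : ℕ}
    (A : Fin n → Set X) (k : ℕ) : ℝ :=
  ∑ s ∈ (Finset.univ : Finset (Fin n)).powersetCard k, P.real (⋂ i ∈ s, A i)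

/-!
Let `G(z) = ∑ k ≤ n, σ_k (-z) ^ k` be the mean of `∏ k, (1 - z 1_{A_k})`, so that `G(0) = 1` and
`G(1) = p`. The point is that `G` has no zeros in the disc `‖1 - z‖ ≤ 1 + 1 / Δ`. To compare the
products over two sets of events, reveal the coordinates event by event: each step that changes the
conditional probability of `A_k` also lowers its exponent `μ_k`, and Markov's inequality for the
probability times `t ^ μ_k`, with `t = (3 Δ) ^ 3`, shows that an event rarely becomes likely. By
induction over the set of events, multiplying by one more factor then changes the conditional mean
by a factor close to `1`.

The Möbius map of the unit disc onto this larger disc with `0 ↦ 0` and `Δ / (Δ + 1) ↦ 1` carries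
`log G` to a function whose Taylor series at `0` converges geometrically at the preimage of `1`.
Its coefficients are power sums of reciprocal roots, so the one of order `k` is a polynomial in
`σ_1, …, σ_k`; truncating the series gives `Q`.
-/

section Mix

variable {ι : Type*} {Ω : ι → Type*}

open scoped Classical in
/-- The point with the coordinates of `x` on `J` and those of `y` off `J`; resampling `y` while
`x` is kept averages over the coordinates off `J`. -/
noncomputable def mix (J : Set ι) (x y : ∀ j, Ω j) : ∀ j, Ω j := J.piecewise x y

theorem mix_of_mem {J : Set ι} {j : ι} (h : j ∈ J) (x y : ∀ j, Ω j) : mix J x y j = x j := by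
  classical exact J.piecewise_eq_of_mem x y h

theorem mix_of_notMem {J : Set ι} {j : ι} (h : j ∉ J) (x y : ∀ j, Ω j) : mix J x y j = y j := by
  classical exact J.piecewise_eq_of_notMem x y h

theorem mix_empty (x y : ∀ j, Ω j) : mix ∅ x y = y :=
  funext fun j => mix_of_notMem (Set.notMem_empty j) x y

theorem mix_mix {J J' : Set ι} (h : J ⊆ J') (x y y' : ∀ j, Ω j) :
    mix J' (mix J x y) y' = mix J x (mix J' y y') := by
  funext j
  by_cases hJ : j ∈ J
  · rw [mix_of_mem (h hJ), mix_of_mem hJ, mix_of_mem hJ]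
  · by_cases hJ' : j ∈ J'
    · rw [mix_of_mem hJ', mix_of_notMem hJ, mix_of_notMem hJ, mix_of_mem hJ']
    · rw [mix_of_notMem hJ', mix_of_notMem hJ, mix_of_notMem hJ']

variable [∀ j, MeasurableSpace (Ω j)]

theorem measurable_mix (J : Set ι) :
    Measurable fun p : (∀ j, Ω j) × (∀ j, Ω j) => mix J p.1 p.2 := by
  refine measurable_pi_iff.2 fun j => ?_
  by_cases h : j ∈ J
  · simp only [mix_of_mem h]; fun_prop
  · simp only [mix_of_notMem h]; fun_prop

theorem measurable_mix_left (J : Set ι) (x : ∀ j, Ω j) : Measurable fun y => mix J x y :=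
  (measurable_mix J).comp measurable_prodMk_left

theorem measurePreserving_mix [Fintype ι] (P : ∀ j, Measure (Ω j)) [∀ j, IsProbabilityMeasure (P j)]
    (J : Set ι) :
    MeasurePreserving (fun p : (∀ j, Ω j) × (∀ j, Ω j) => mix J p.1 p.2)
      ((Measure.pi P).prod (Measure.pi P)) (Measure.pi P) := by
  classical
  refine ⟨measurable_mix J, (Measure.pi_eq fun s hs => ?_).symm⟩
  have preimage_box : (fun p : (∀ j, Ω j) × (∀ j, Ω j) => mix J p.1 p.2) ⁻¹' Set.univ.pi s =
      (Set.univ.pi fun j => if j ∈ J then s j else Set.univ) ×ˢ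
      (Set.univ.pi fun j => if j ∈ J then Set.univ else s j) := by
    ext p
    simp only [Set.mem_preimage, Set.mem_pi, Set.mem_univ, true_imp_iff, Set.mem_prod,
      ← forall_and]
    refine forall_congr' fun j => ?_
    by_cases h : j ∈ J <;> simp [h, mix_of_mem, mix_of_notMem]
  rw [Measure.map_apply (measurable_mix J) (MeasurableSet.univ_pi hs), preimage_box,
    Measure.prod_prod, Measure.pi_pi, Measure.pi_pi, ← Finset.prod_mul_distrib]
  refine Finset.prod_congr rfl fun j _ => ?_
  by_cases h : j ∈ J <;> simp [h]

end Mix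

/-- Bounded strongly measurable functions: a class of functions that are integrable for every
finite measure and that is stable under products and under `condMean`. -/
structure BddMeasurable {X E : Type*} [MeasurableSpace X] [NormedAddCommGroup E] (g : X → E) :
    Prop where
  stronglyMeasurable : StronglyMeasurable g
  bounded : ∃ C, ∀ x, ‖g x‖ ≤ C

namespace BddMeasurable

variable {X I E R : Type*} [MeasurableSpace X] [NormedAddCommGroup E]

theorem norm {g : X → E} (h : BddMeasurable g) : BddMeasurable fun x => ‖g x‖ :=
  ⟨h.stronglyMeasurable.norm, by simpa only [norm_norm] using h.bounded⟩

theorem const (c : E) : BddMeasurable fun _ : X => c :=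
  ⟨stronglyMeasurable_const, ‖c‖, fun _ => le_rfl⟩

theorem add {f g : X → E} (hf : BddMeasurable f) (hg : BddMeasurable g) :
    BddMeasurable fun x => f x + g x := by
  obtain ⟨a, ha⟩ := hf.bounded
  obtain ⟨b, hb⟩ := hg.bounded
  exact ⟨hf.stronglyMeasurable.add hg.stronglyMeasurable, a + b,
    fun x => (norm_add_le _ _).trans (add_le_add (ha x) (hb x))⟩

theorem mul [NormedRing R] {f g : X → R} (hf : BddMeasurable f) (hg : BddMeasurable g) :
    BddMeasurable fun x => f x * g x := by
  obtain ⟨a, ha⟩ := hf.bounded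
  obtain ⟨b, hb⟩ := hg.bounded
  exact ⟨hf.stronglyMeasurable.mul hg.stronglyMeasurable, a * b, fun x => (norm_mul_le _ _).trans
    (mul_le_mul (ha x) (hb x) (norm_nonneg _) ((norm_nonneg _).trans (ha x)))⟩

theorem sum {f : I → X → E} (S : Finset I) (h : ∀ i ∈ S, BddMeasurable (f i)) :
    BddMeasurable fun x => ∑ i ∈ S, f i x := by
  induction S using Finset.cons_induction with
  | empty => simpa only [Finset.sum_empty] using const (0 : E)
  | cons i S hi ih =>
    simp only [Finset.sum_cons]
    exact (h i (by simp)).add (ih fun j hj => h j (by simp [hj]))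

theorem prod [NormedCommRing R] {f : I → X → R} (S : Finset I)
    (h : ∀ i ∈ S, BddMeasurable (f i)) : BddMeasurable fun x => ∏ i ∈ S, f i x := by
  induction S using Finset.cons_induction with
  | empty => simpa only [Finset.prod_empty] using const (1 : R)
  | cons i S hi ih =>
    simp only [Finset.prod_cons]
    exact (h i (by simp)).mul (ih fun j hj => h j (by simp [hj]))

theorem indicator_const (c : E) {A : Set X} (hA : MeasurableSet A) :
    BddMeasurable (A.indicator fun _ => c) :=
  ⟨stronglyMeasurable_const.indicator hA, ‖c‖, fun _ => norm_indicator_le_norm_self _ _⟩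

theorem comp {Y : Type*} [MeasurableSpace Y] {g : X → E} (h : BddMeasurable g) {φ : Y → X}
    (hφ : Measurable φ) : BddMeasurable fun y => g (φ y) :=
  ⟨h.stronglyMeasurable.comp_measurable hφ, h.bounded.imp fun _ hC _ => hC _⟩

theorem integrable {g : X → E} (h : BddMeasurable g) (μ : Measure X) [IsFiniteMeasure μ] :
    Integrable g μ := by
  obtain ⟨C, hC⟩ := h.bounded
  exact .of_bound h.stronglyMeasurable.aestronglyMeasurable C (.of_forall hC)

end BddMeasurable

section CondMean

variable {ι : Type*} [Fintype ι] {Ω : ι → Type*} [∀ j, MeasurableSpace (Ω j)]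
  (P : ∀ j, Measure (Ω j)) {E : Type*} [NormedAddCommGroup E] [NormedSpace ℝ E]
  {𝕜 : Type*} [RCLike 𝕜]

/-- The conditional expectation of `g` given the coordinates in `J`, as a function defined
everywhere on the product. -/
noncomputable def condMean (J : Set ι) (g : (∀ j, Ω j) → E) (x : ∀ j, Ω j) : E :=
  ∫ y, g (mix J x y) ∂(Measure.pi P)

theorem condMean_empty (g : (∀ j, Ω j) → E) (x : ∀ j, Ω j) :
    condMean P ∅ g x = ∫ y, g y ∂(Measure.pi P) := by
  simp only [condMean, mix_empty]

theorem condMean_congr {f g : (∀ j, Ω j) → E} (J : Set ι) (x : ∀ j, Ω j)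
    (h : ∀ y, f (mix J x y) = g (mix J x y)) : condMean P J f x = condMean P J g x := by
  simp only [condMean, h]

theorem norm_condMean_le (J : Set ι) (g : (∀ j, Ω j) → E) (x : ∀ j, Ω j) :
    ‖condMean P J g x‖ ≤ condMean P J (fun y => ‖g y‖) x :=
  norm_integral_le_integral_norm _

theorem condMean_const_mul (c : 𝕜) (g : (∀ j, Ω j) → 𝕜) (J : Set ι) (x : ∀ j, Ω j) :
    condMean P J (fun y => c * g y) x = c * condMean P J g x :=
  integral_const_mul _ _

theorem condMean_mul_left {f : (∀ j, Ω j) → 𝕜} {J : Set ι} (hf : DependsOn f J)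
    (g : (∀ j, Ω j) → 𝕜) (x : ∀ j, Ω j) :
    condMean P J (fun y => f y * g y) x = f x * condMean P J g x := by
  rw [← condMean_const_mul]
  exact condMean_congr P J x fun y => by rw [hf fun j hj => mix_of_mem hj x y]

theorem dependsOn_condMean (g : (∀ j, Ω j) → E) (J : Set ι) : DependsOn (condMean P J g) J := by
  intro x y hxy
  have mix_eq (z) : mix J x z = mix J y z := by
    funext j
    by_cases h : j ∈ J
    · rw [mix_of_mem h, mix_of_mem h, hxy j h]
    · rw [mix_of_notMem h, mix_of_notMem h]
  simp only [condMean, mix_eq]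

theorem condMean_union_mix {g : (∀ j, Ω j) → E} {V J W : Set ι} (hg : DependsOn g V)
    (h : W ∩ V ⊆ J) (x y : ∀ j, Ω j) :
    condMean P (J ∪ W) g (mix J x y) = condMean P J g x := by
  refine integral_congr_ae (.of_forall fun z => hg fun j hj => ?_)
  by_cases hJ : j ∈ J
  · rw [mix_of_mem (Set.mem_union_left W hJ), mix_of_mem hJ, mix_of_mem hJ]
  · have hJW : j ∉ J ∪ W := fun h' => h'.elim hJ fun hW => hJ (h ⟨hW, hj⟩)
    rw [mix_of_notMem hJW, mix_of_notMem hJ]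

variable [∀ j, IsProbabilityMeasure (P j)]

theorem condMean_mono {f g : (∀ j, Ω j) → ℝ} (hf : BddMeasurable f) (hg : BddMeasurable g)
    (J : Set ι) (x : ∀ j, Ω j) (h : ∀ y, f (mix J x y) ≤ g (mix J x y)) :
    condMean P J f x ≤ condMean P J g x :=
  integral_mono ((hf.comp (measurable_mix_left J x)).integrable _)
    ((hg.comp (measurable_mix_left J x)).integrable _) h

theorem condMean_add {f g : (∀ j, Ω j) → E} (hf : BddMeasurable f) (hg : BddMeasurable g)
    (J : Set ι) (x : ∀ j, Ω j) :
    condMean P J (fun y => f y + g y) x = condMean P J f x + condMean P J g x :=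
  integral_add ((hf.comp (measurable_mix_left J x)).integrable _)
    ((hg.comp (measurable_mix_left J x)).integrable _)

theorem condMean_sum {I : Type*} {f : I → (∀ j, Ω j) → E} (S : Finset I)
    (hf : ∀ i ∈ S, BddMeasurable (f i)) (J : Set ι) (x : ∀ j, Ω j) :
    condMean P J (fun y => ∑ i ∈ S, f i y) x = ∑ i ∈ S, condMean P J (f i) x :=
  integral_finsetSum S fun i hi => ((hf i hi).comp (measurable_mix_left J x)).integrable _

theorem bddMeasurable_condMean {g : (∀ j, Ω j) → E} (h : BddMeasurable g) (J : Set ι) :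
    BddMeasurable (condMean P J g) := by
  obtain ⟨C, hC⟩ := h.bounded
  refine ⟨(h.stronglyMeasurable.comp_measurable (measurable_mix J)).integral_prod_right', C,
    fun x => ?_⟩
  simpa only [condMean, probReal_univ, mul_one] using
    norm_integral_le_of_norm_le_const (μ := Measure.pi P) (.of_forall fun y => hC (mix J x y))

theorem condMean_condMean {g : (∀ j, Ω j) → E} (h : BddMeasurable g) {J J' : Set ι}
    (hJ : J ⊆ J') (x : ∀ j, Ω j) : condMean P J (condMean P J' g) x = condMean P J g x := by
  have hmix : BddMeasurable fun y => g (mix J x y) := h.comp (measurable_mix_left J x)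
  symm
  calc condMean P J g x
      = ∫ p, g (mix J x (mix J' p.1 p.2)) ∂(Measure.pi P).prod (Measure.pi P) := by
        conv_lhs => rw [condMean, ← (measurePreserving_mix P J').map_eq]
        exact integral_map (measurable_mix J').aemeasurable
          hmix.stronglyMeasurable.aestronglyMeasurable
    _ = condMean P J (condMean P J' g) x := by
        rw [integral_prod _ ((hmix.comp (measurable_mix J')).integrable _)]
        simp only [condMean, mix_mix hJ]

variable [CompleteSpace E]

theorem condMean_const (c : E) (J : Set ι) (x : ∀ j, Ω j) : condMean P J (fun _ => c) x = c := by
  simp only [condMean, integral_const, probReal_univ, one_smul]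

theorem condMean_of_dependsOn {f : (∀ j, Ω j) → E} {J : Set ι} (hf : DependsOn f J)
    (x : ∀ j, Ω j) : condMean P J f x = f x := by
  rw [← condMean_const P (f x) J x]
  exact condMean_congr P J x fun y => hf fun j hj => mix_of_mem hj x y

end CondMean

section RevealRank

variable {ι I : Type*} (W : I → Set ι)

/-- The number of coordinates of the event `k` off `J`, or one more than the number of events that
share such a coordinate with it, whichever is smaller. Each event occupies the coordinates `W k`;
this is the exponent `μ` of the local lemma once the coordinates in `J` are known. -/
noncomputable def revealRank (J : Set ι) (k : I) : ℕ :=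
  min (W k \ J).ncard ({j | j ≠ k ∧ ¬ W j ∩ W k ⊆ J}.ncard + 1)

theorem revealRank_anti [Finite ι] [Finite I] {J J' : Set ι} (h : J ⊆ J') (k : I) :
    revealRank W J' k ≤ revealRank W J k := by
  refine min_le_min (Set.ncard_le_ncard (Set.sdiff_subset_sdiff_right h) (Set.toFinite _)) ?_
  refine Nat.add_le_add_right (Set.ncard_le_ncard ?_ (Set.toFinite _)) 1
  exact fun j hj => ⟨hj.1, fun hs => hj.2 (hs.trans h)⟩

variable {W}

theorem subset_of_revealRank_eq_zero [Finite ι] {J : Set ι} {k : I}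
    (h : revealRank W J k = 0) : W k ⊆ J := by
  have hcard : (W k \ J).ncard = 0 := by
    rw [revealRank] at h
    omega
  rwa [Set.ncard_eq_zero (Set.toFinite _), Set.sdiff_eq_empty] at hcard

theorem revealRank_union_lt [Finite ι] [Finite I] {J : Set ι} {u k : I} (huk : u ≠ k)
    (h : ¬ W u ∩ W k ⊆ J) : revealRank W (J ∪ W u) k < revealRank W J k := by
  obtain ⟨l, ⟨hlu, hlk⟩, hlJ⟩ := Set.not_subset.1 h
  have coords_lt : (W k \ (J ∪ W u)).ncard < (W k \ J).ncard := by
    refine Set.ncard_lt_ncard ⟨Set.sdiff_subset_sdiff_right Set.subset_union_left, fun hs => ?_⟩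
      (Set.toFinite _)
    exact (hs ⟨hlk, hlJ⟩).2 (Or.inr hlu)
  have events_lt : {j | j ≠ k ∧ ¬ W j ∩ W k ⊆ J ∪ W u}.ncard <
      {j | j ≠ k ∧ ¬ W j ∩ W k ⊆ J}.ncard := by
    refine Set.ncard_lt_ncard ⟨fun j hj => ⟨hj.1, fun hs => hj.2
      (hs.trans Set.subset_union_left)⟩, fun hs => ?_⟩ (Set.toFinite _)
    exact (hs ⟨huk, h⟩).2 (Set.inter_subset_left.trans Set.subset_union_right)
  simp only [revealRank]
  omega

variable (W) in
open scoped Classical in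
/-- The events of `S` that share a coordinate off `J` with the event `u`, so that revealing the
coordinates of `u` tells something new about them. -/
noncomputable def touching (S : Finset I) (J : Set ι) (u : I) : Finset I :=
  S.filter fun k => ¬ W u ∩ W k ⊆ J

theorem mem_touching {S : Finset I} {J : Set ι} {u k : I} :
    k ∈ touching W S J u ↔ k ∈ S ∧ ¬ W u ∩ W k ⊆ J := by
  classical exact Finset.mem_filter

theorem touching_subset (S : Finset I) (J : Set ι) (u : I) : touching W S J u ⊆ S :=
  fun _ hk => (mem_touching.1 hk).1

theorem card_touching_le [Finite I] {d : ℕ} {S : Finset I} {u : I}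
    (hd : {j | j ≠ u ∧ (W j ∩ W u).Nonempty}.ncard ≤ d) (hu : u ∉ S) (J : Set ι) :
    (touching W S J u).card ≤ d := by
  refine le_trans ?_ hd
  rw [← Set.ncard_coe_finset]
  refine Set.ncard_le_ncard (fun k hk => ?_) (Set.toFinite _)
  obtain ⟨hkS, hk⟩ := mem_touching.1 hk
  obtain ⟨l, ⟨hlu, hlk⟩, -⟩ := Set.not_subset.1 hk
  exact ⟨fun h => hu (h ▸ hkS), l, hlk, hlu⟩

end RevealRank

section MeanNorm

variable {ι : Type*} [Fintype ι] {Ω : ι → Type*} [∀ j, MeasurableSpace (Ω j)]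
  (P : ∀ j, Measure (Ω j)) [∀ j, IsProbabilityMeasure (P j)]
  {E : Type*} [NormedAddCommGroup E] [NormedSpace ℝ E]

/-- The mean, given the coordinates in `J`, of the modulus of the conditional expectation of `g`
given the coordinates in `V`. -/
noncomputable def meanNorm (J V : Set ι) (g : (∀ j, Ω j) → E) : (∀ j, Ω j) → ℝ :=
  condMean P J fun y => ‖condMean P V g y‖

theorem meanNorm_self (g : (∀ j, Ω j) → E) (J : Set ι) (x : ∀ j, Ω j) :
    meanNorm P J J g x = ‖condMean P J g x‖ :=
  condMean_of_dependsOn P (f := fun y => ‖condMean P J g y‖)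
    (fun _ _ hxy => congrArg norm (dependsOn_condMean P g J hxy)) x

theorem condMean_meanNorm {g : (∀ j, Ω j) → E} (hg : BddMeasurable g) {J J' : Set ι} (V : Set ι)
    (h : J ⊆ J') (x : ∀ j, Ω j) :
    condMean P J (meanNorm P J' V g) x = meanNorm P J V g x :=
  condMean_condMean P (bddMeasurable_condMean P hg V).norm h x

theorem meanNorm_mono {g : (∀ j, Ω j) → E} (hg : BddMeasurable g) {J V V' : Set ι}
    (hV : J ⊆ V) (hV' : V ⊆ V') (x : ∀ j, Ω j) : meanNorm P J V g x ≤ meanNorm P J V' g x := by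
  rw [← condMean_meanNorm P hg V' hV]
  refine condMean_mono P (bddMeasurable_condMean P hg V).norm
    (bddMeasurable_condMean P (bddMeasurable_condMean P hg V').norm V) J x fun y => ?_
  rw [← condMean_condMean P hg hV']
  exact norm_condMean_le P V _ _

end MeanNorm

section AvoidProd

variable {X I : Type*} (A : I → Set X)

/-- The product over `k ∈ S` of the functions that are `1 - z` on `A k` and `1` off `A k`; for
`z = 1` it is the indicator of the set of points that avoid all of the `A k`. -/
noncomputable def avoidProd (z : ℂ) (S : Finset I) (x : X) : ℂ :=
  ∏ k ∈ S, (1 - z * (A k).indicator (fun _ => (1 : ℂ)) x)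

variable {A}

theorem norm_avoidProd_le {z : ℂ} {R : ℝ} (hR : 1 ≤ R) (hz : ‖1 - z‖ ≤ R) (S : Finset I) (x : X) :
    ‖avoidProd A z S x‖ ≤ R ^ S.card := by
  rw [avoidProd, norm_prod, ← Finset.prod_const]
  refine Finset.prod_le_prod (fun _ _ => norm_nonneg _) fun k _ => ?_
  by_cases hx : x ∈ A k
  · simpa [hx] using hz
  · simpa [hx] using hR

theorem avoidProd_mul_sdiff [DecidableEq I] (z : ℂ) {S B : Finset I} (hB : B ⊆ S) (x : X) :
    avoidProd A z B x * avoidProd A z (S \ B) x = avoidProd A z S x := by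
  rw [mul_comm]
  exact Finset.prod_sdiff hB

theorem bddMeasurable_avoidProd [MeasurableSpace X] (hA : ∀ k, MeasurableSet (A k)) (z : ℂ)
    (S : Finset I) : BddMeasurable (avoidProd A z S) := by
  refine .prod S fun k _ => ?_
  simpa only [neg_mul, sub_eq_add_neg] using
    (BddMeasurable.const (1 : ℂ)).add ((BddMeasurable.const (-z)).mul (.indicator_const 1 (hA k)))

end AvoidProd

section DependsOn

variable {ι I : Type*} {Ω : ι → Type*}

theorem dependsOn_indicator_const {E : Type*} [Zero E] {B : Set (∀ j, Ω j)} {V : Set ι}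
    (h : DependsOn (fun x => x ∈ B) V) (c : E) : DependsOn (B.indicator fun _ => c) V := by
  intro x y hxy
  have mem_iff : x ∈ B ↔ y ∈ B := iff_of_eq (h hxy)
  by_cases hx : x ∈ B
  · rw [Set.indicator_of_mem hx, Set.indicator_of_mem (mem_iff.1 hx)]
  · rw [Set.indicator_of_notMem hx, Set.indicator_of_notMem (mt mem_iff.2 hx)]

theorem dependsOn_avoidProd {A : I → Set (∀ j, Ω j)} {W : I → Set ι}
    (hW : ∀ k, DependsOn (fun x => x ∈ A k) (W k)) (z : ℂ) {S : Finset I} {V : Set ι}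
    (hV : ∀ k ∈ S, W k ⊆ V) : DependsOn (avoidProd A z S) V := by
  refine fun x y hxy => Finset.prod_congr rfl fun k hk => ?_
  rw [dependsOn_indicator_const (hW k) 1 fun j hj => hxy j (hV k hk hj)]

end DependsOn

section Risk

variable {ι : Type*} [Fintype ι] {Ω : ι → Type*} [∀ j, MeasurableSpace (Ω j)]
  (P : ∀ j, Measure (Ω j)) {I : Type*} (A : I → Set (∀ j, Ω j)) (W : I → Set ι)

/-- The conditional probability of the event `A k`, given the coordinates in `J`. -/
noncomputable def condProb (J : Set ι) (k : I) : (∀ j, Ω j) → ℝ :=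
  condMean P J ((A k).indicator fun _ => (1 : ℝ))

/-- The conditional probability of `A k` given the coordinates in `J`, weighted by `t` to the power
of the rank of `k`: the potential that the revealing process keeps below `1`. -/
noncomputable def risk (t : ℝ) (J : Set ι) (k : I) (x : ∀ j, Ω j) : ℝ :=
  t ^ revealRank W J k * condProb P A J k x

/-- Given the coordinates of `x` in `J`, every event of `S` is still unlikely. -/
def Unlikely (t : ℝ) (S : Finset I) (J : Set ι) (x : ∀ j, Ω j) : Prop :=
  ∀ k ∈ S, risk P A W t J k x < 1

open scoped Classical in
/-- The events of `S` that are no longer unlikely, given the coordinates of `x` in `J`. -/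
noncomputable def likely (t : ℝ) (S : Finset I) (J : Set ι) (x : ∀ j, Ω j) : Finset I :=
  S.filter fun k => 1 ≤ risk P A W t J k x

variable {P A W} {t : ℝ} {S : Finset I} {J : Set ι} {x : ∀ j, Ω j} {u k : I}

theorem Unlikely.subset {S' : Finset I} (h : Unlikely P A W t S J x) (hS : S' ⊆ S) :
    Unlikely P A W t S' J x :=
  fun k hk => h k (hS hk)

theorem mem_likely : k ∈ likely P A W t S J x ↔ k ∈ S ∧ 1 ≤ risk P A W t J k x := by
  classical exact Finset.mem_filter

theorem likely_nonempty (h : ¬ Unlikely P A W t S J x) : (likely P A W t S J x).Nonempty := by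
  simp only [Unlikely, not_forall, not_lt] at h
  obtain ⟨k, hk, hk1⟩ := h
  exact ⟨k, mem_likely.2 ⟨hk, hk1⟩⟩

theorem unlikely_sdiff_likely [DecidableEq I] :
    Unlikely P A W t (S \ likely P A W t S J x) J x := by
  intro k hk
  rw [Finset.mem_sdiff, mem_likely] at hk
  exact not_le.1 fun h => hk.2 ⟨hk.1, h⟩

theorem condProb_nonneg (J : Set ι) (k : I) (x : ∀ j, Ω j) : 0 ≤ condProb P A J k x :=
  integral_nonneg fun _ => Set.indicator_nonneg (fun _ _ => zero_le_one) _

theorem risk_nonneg (ht : 0 ≤ t) (J : Set ι) (k : I) (x : ∀ j, Ω j) : 0 ≤ risk P A W t J k x :=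
  mul_nonneg (pow_nonneg ht _) (condProb_nonneg J k x)

theorem risk_union_mix_le [Finite I] (hW : DependsOn (fun x => x ∈ A k) (W k)) (ht : 1 ≤ t)
    (h : W u ∩ W k ⊆ J) (x y : ∀ j, Ω j) :
    risk P A W t (J ∪ W u) k (mix J x y) ≤ risk P A W t J k x := by
  rw [risk, condProb, condMean_union_mix P (dependsOn_indicator_const hW 1) h]
  exact mul_le_mul_of_nonneg_right
    (pow_le_pow_right₀ ht (revealRank_anti W Set.subset_union_left k)) (condProb_nonneg J k x)

theorem likely_subset_touching [Finite I] (hW : ∀ k, DependsOn (fun x => x ∈ A k) (W k))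
    (ht : 1 ≤ t) (h : Unlikely P A W t S J x) (u : I) (y : ∀ j, Ω j) :
    likely P A W t S (J ∪ W u) (mix J x y) ⊆ touching W S J u := by
  intro k hk
  obtain ⟨hkS, hk⟩ := mem_likely.1 hk
  exact mem_touching.2 ⟨hkS, fun hJ =>
    (hk.trans (risk_union_mix_le (hW k) ht hJ x y)).not_gt (h k hkS)⟩

theorem one_le_sum_risk_touching [Finite I] (hW : ∀ k, DependsOn (fun x => x ∈ A k) (W k))
    (ht : 1 ≤ t) (h : Unlikely P A W t S J x) (y : ∀ j, Ω j)
    (hbad : ¬ Unlikely P A W t S (J ∪ W u) (mix J x y)) :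
    1 ≤ ∑ k ∈ touching W S J u, risk P A W t (J ∪ W u) k (mix J x y) := by
  obtain ⟨k, hk⟩ := likely_nonempty hbad
  exact (mem_likely.1 hk).2.trans (Finset.single_le_sum
    (f := fun k => risk P A W t (J ∪ W u) k (mix J x y))
    (fun k _ => risk_nonneg (zero_le_one.trans ht) _ k _)
    (likely_subset_touching hW ht h u y hk))

variable [∀ j, IsProbabilityMeasure (P j)]

theorem bddMeasurable_risk (hA : MeasurableSet (A k)) (t : ℝ) (J : Set ι) :
    BddMeasurable (risk P A W t J k) :=
  (BddMeasurable.const _).mul (bddMeasurable_condMean P (.indicator_const 1 hA) J)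

/-- If no coordinate of `k` is hidden, then its conditional probability is `0` or `1`. -/
theorem condProb_le_inv [Finite I] (hW : DependsOn (fun x => x ∈ A k) (W k)) (ht : 1 ≤ t)
    (h : risk P A W t J k x < 1) : condProb P A J k x ≤ t⁻¹ := by
  have ht0 : 0 < t := by linarith
  rcases Nat.eq_zero_or_pos (revealRank W J k) with hrank | hrank
  · have condProb_eq : condProb P A J k x = (A k).indicator (fun _ => (1 : ℝ)) x :=
      condMean_of_dependsOn P ((dependsOn_indicator_const hW 1).mono
        (subset_of_revealRank_eq_zero hrank)) x
    rw [risk, hrank, pow_zero, one_mul, condProb_eq] at h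
    rw [condProb_eq]
    by_cases hx : x ∈ A k
    · simp [hx] at h
    · simpa [hx] using ht0.le
  · have : t * condProb P A J k x ≤ risk P A W t J k x :=
      mul_le_mul_of_nonneg_right (le_self_pow₀ ht hrank.ne') (condProb_nonneg J k x)
    rw [inv_eq_one_div, le_div_iff₀' ht0]
    linarith

theorem condMean_risk_union_le [Finite I] (hA : MeasurableSet (A k)) (ht : 1 ≤ t) (huk : u ≠ k)
    (h : ¬ W u ∩ W k ⊆ J) (x : ∀ j, Ω j) :
    condMean P J (risk P A W t (J ∪ W u) k) x ≤ risk P A W t J k x / t := by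
  have tower : condMean P J (risk P A W t (J ∪ W u) k) x =
      t ^ revealRank W (J ∪ W u) k * condProb P A J k x := by
    unfold risk condProb
    rw [condMean_const_mul, condMean_condMean P (.indicator_const 1 hA) Set.subset_union_left]
  rw [tower, le_div_iff₀ (by linarith), mul_right_comm, ← pow_succ]
  exact mul_le_mul_of_nonneg_right (pow_le_pow_right₀ ht (revealRank_union_lt huk h))
    (condProb_nonneg J k x)

end Risk

/-- Constants for which the induction over the number of events closes. The modulus of
`1 - z` is at most `1 + η`; revealing one more event costs a factor `κ` at worst and `1 + η` on
average, dropping one event costs a factor in `[1 - a, 1 + a]`, and `ρ` pays for dropping and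
restoring all of the at most `d` neighbours of an event. The base of the weights in `risk` is
`t`. -/
structure RevealConstants (d : ℕ) (z : ℂ) where
  (η κ t a ρ : ℝ)
  norm_one_sub_le : ‖1 - z‖ ≤ 1 + η
  η_nonneg : 0 ≤ η
  one_le_t : 1 ≤ t
  a_nonneg : 0 ≤ a
  a_lt_one : a < 1
  one_le_ρ : 1 ≤ ρ
  norm_mul_κ_le : ‖z‖ * κ ≤ a * t
  one_add_pow_le : (1 + a) ^ d ≤ ρ * (1 - a) ^ d
  pow_mul_ρ_le : (1 + η) ^ (2 * d) * ρ ≤ κ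
  ρ_add_le : ρ + κ * (d / t) ≤ 1 + η

namespace RevealConstants

variable {d : ℕ} {z : ℂ} (c : RevealConstants d z)

theorem one_le_one_add_η : 1 ≤ 1 + c.η := le_add_of_nonneg_right c.η_nonneg

theorem ρ_nonneg : 0 ≤ c.ρ := zero_le_one.trans c.one_le_ρ

theorem ρ_le_κ : c.ρ ≤ c.κ :=
  (le_mul_of_one_le_left c.ρ_nonneg (one_le_pow₀ c.one_le_one_add_η)).trans c.pow_mul_ρ_le

theorem κ_nonneg : 0 ≤ c.κ := c.ρ_nonneg.trans c.ρ_le_κ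

theorem t_pos : 0 < c.t := zero_lt_one.trans_le c.one_le_t

end RevealConstants

section ZeroFree

variable {ι : Type*} [Fintype ι] {Ω : ι → Type*} [∀ j, MeasurableSpace (Ω j)]
  {P : ∀ j, Measure (Ω j)} {I : Type*} {A : I → Set (∀ j, Ω j)} {W : I → Set ι}
  {d : ℕ} {z : ℂ} {c : RevealConstants d z} {S : Finset I} {J : Set ι} {x : ∀ j, Ω j} {u : I}

variable (P A W c S) in
/-- As long as the events of `S` are unlikely, revealing the coordinates of one more event
multiplies the conditional expectation of `avoidProd A z S` by at most `κ`, and revealing those of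
the events in `U` multiplies its mean modulus by at most `(1 + η) ^ #U`. -/
structure RevealBounds : Prop where
  norm_le : ∀ {J x}, Unlikely P A W c.t S J x → ∀ {u}, u ∉ S → ∀ y,
    ‖condMean P (J ∪ W u) (avoidProd A z S) (mix J x y)‖ ≤
      c.κ * ‖condMean P J (avoidProd A z S) x‖
  meanNorm_le : ∀ {J x}, Unlikely P A W c.t S J x → ∀ {U : Finset I}, Disjoint U S →
    meanNorm P J (J ∪ ⋃ v ∈ U, W v) (avoidProd A z S) x ≤
      (1 + c.η) ^ U.card * ‖condMean P J (avoidProd A z S) x‖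

theorem condMean_avoidProd_sdiff_touching [DecidableEq I]
    (hW : ∀ k, DependsOn (fun x => x ∈ A k) (W k)) (z : ℂ) (S : Finset I) (J : Set ι) (u : I)
    (x y : ∀ j, Ω j) :
    condMean P (J ∪ W u) (avoidProd A z (S \ touching W S J u)) (mix J x y) =
      condMean P J (avoidProd A z (S \ touching W S J u)) x := by
  refine condMean_union_mix P (V := ⋃ k ∈ S \ touching W S J u, W k)
    (dependsOn_avoidProd hW z fun k hk => Set.subset_biUnion_of_mem (u := W) hk) ?_ x y
  simp only [Set.inter_iUnion₂, Set.iUnion_subset_iff, Finset.mem_sdiff, mem_touching]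
  exact fun k hk => by_contra fun hJ => hk.2 ⟨hk.1, hJ⟩

variable [∀ j, IsProbabilityMeasure (P j)]
  (hA : ∀ k, MeasurableSet (A k)) (hW : ∀ k, DependsOn (fun x => x ∈ A k) (W k))

include hA hW in
theorem condMean_avoidProd_insert [DecidableEq I] (z : ℂ) {i : I} (hi : i ∉ S) (J : Set ι)
    (x : ∀ j, Ω j) :
    condMean P J (avoidProd A z (insert i S)) x = condMean P J (avoidProd A z S) x +
      -z * condMean P J (fun y => (A i).indicator (fun _ => (1 : ℂ)) y *
        condMean P (J ∪ W i) (avoidProd A z S) y) x := by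
  set χ : (∀ j, Ω j) → ℂ := (A i).indicator fun _ => (1 : ℂ)
  have hS := bddMeasurable_avoidProd hA z S
  have hχS : BddMeasurable fun y => χ y * avoidProd A z S y :=
    (BddMeasurable.indicator_const 1 (hA i)).mul hS
  have expand : avoidProd A z (insert i S) =
      fun y => avoidProd A z S y + -z * (χ y * avoidProd A z S y) := by
    funext y
    simp only [avoidProd, Finset.prod_insert hi, χ]
    ring
  have tower : condMean P J (fun y => χ y * avoidProd A z S y) x =
      condMean P J (fun y => χ y * condMean P (J ∪ W i) (avoidProd A z S) y) x := by
    rw [← condMean_condMean P hχS (Set.subset_union_left : J ⊆ J ∪ W i)]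
    exact condMean_congr P J x fun y => condMean_mul_left P
      ((dependsOn_indicator_const (hW i) 1).mono Set.subset_union_right) _ _
  rw [expand, condMean_add P hS ((BddMeasurable.const (-z)).mul hχS), condMean_const_mul, tower]

include hA hW in
theorem norm_condMean_avoidProd_insert_sub_le [Finite I] [DecidableEq I]
    (hS : RevealBounds P A W c S) {i : I} (hi : i ∉ S)
    (h : Unlikely P A W c.t (insert i S) J x) :
    ‖condMean P J (avoidProd A z (insert i S)) x - condMean P J (avoidProd A z S) x‖ ≤
      c.a * ‖condMean P J (avoidProd A z S) x‖ := by
  set F := ‖condMean P J (avoidProd A z S) x‖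
  set χ : (∀ j, Ω j) → ℂ := (A i).indicator fun _ => (1 : ℂ)
  have hrevealed := bddMeasurable_condMean P (bddMeasurable_avoidProd hA z S) (J ∪ W i)
  have mean_le : ‖condMean P J (fun y => χ y * condMean P (J ∪ W i) (avoidProd A z S) y) x‖ ≤
      c.κ * F * condProb P A J i x := by
    refine (norm_condMean_le P _ _ _).trans ?_
    rw [condProb, ← condMean_const_mul]
    refine condMean_mono P ((BddMeasurable.indicator_const 1 (hA i)).mul hrevealed).norm
      ((BddMeasurable.const _).mul (.indicator_const 1 (hA i))) J x fun y => ?_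
    rw [norm_mul]
    by_cases hy : mix J x y ∈ A i
    · simpa [χ, hy] using hS.norm_le (h.subset (Finset.subset_insert _ _)) hi y
    · simp [hy]
  have hκ := c.κ_nonneg
  rw [condMean_avoidProd_insert hA hW z hi, add_sub_cancel_left, norm_mul, norm_neg]
  calc ‖z‖ * _ ≤ ‖z‖ * (c.κ * F * condProb P A J i x) := by gcongr
    _ ≤ ‖z‖ * (c.κ * F * c.t⁻¹) := by
      gcongr
      exact condProb_le_inv (hW i) c.one_le_t (h i (Finset.mem_insert_self i S))
    _ = ‖z‖ * c.κ / c.t * F := by ring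
    _ ≤ c.a * F := by
      gcongr
      exact (div_le_iff₀ c.t_pos).2 c.norm_mul_κ_le

include hA hW in
theorem norm_condMean_avoidProd_union_mem_Icc [Finite I] [DecidableEq I] {N : Finset I}
    (hS : ∀ S' ⊂ N ∪ S, RevealBounds P A W c S') (hN : Disjoint N S)
    (h : Unlikely P A W c.t (N ∪ S) J x) :
    ‖condMean P J (avoidProd A z (N ∪ S)) x‖ ∈
      Set.Icc ((1 - c.a) ^ N.card * ‖condMean P J (avoidProd A z S) x‖)
        ((1 + c.a) ^ N.card * ‖condMean P J (avoidProd A z S) x‖) := by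
  induction N using Finset.induction_on with
  | empty => simp
  | insert i N hi ih =>
    obtain ⟨hiS, hNS⟩ := Finset.disjoint_insert_left.1 hN
    have hiNS : i ∉ N ∪ S := by simp [hi, hiS]
    rw [Finset.insert_union] at hS h ⊢
    have hlt : N ∪ S ⊂ insert i (N ∪ S) := Finset.ssubset_insert hiNS
    obtain ⟨lower, upper⟩ := ih (fun S' hS' => hS S' (hS'.trans hlt)) hNS (h.subset hlt.subset)
    have step := norm_condMean_avoidProd_insert_sub_le hA hW (hS _ hlt) hiNS h
    set G' := condMean P J (avoidProd A z (insert i (N ∪ S))) x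
    set G := condMean P J (avoidProd A z (N ∪ S)) x
    have step_lower : (1 - c.a) * ‖G‖ ≤ ‖G'‖ := by
      linarith [norm_le_norm_add_norm_sub G' G]
    have step_upper : ‖G'‖ ≤ (1 + c.a) * ‖G‖ := by
      linarith [norm_le_norm_add_norm_sub' G' G]
    have ha := c.a_lt_one
    have ha' := c.a_nonneg
    rw [Finset.card_insert_of_notMem hi, pow_succ', pow_succ', mul_assoc, mul_assoc]
    exact ⟨(mul_le_mul_of_nonneg_left lower (by linarith)).trans step_lower,
      step_upper.trans (mul_le_mul_of_nonneg_left upper (by linarith))⟩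

variable (hd : ∀ u, {j | j ≠ u ∧ (W j ∩ W u).Nonempty}.ncard ≤ d)

include hA hW hd in
/-- Without the events that touch `u` nothing changes, so drop all of them before the reveal and
restore those outside `B` after it. -/
theorem norm_condMean_union_avoidProd_sdiff_le [Finite I] [DecidableEq I]
    (hS : ∀ S' ⊂ S, RevealBounds P A W c S') (h : Unlikely P A W c.t S J x) (hu : u ∉ S)
    (y : ∀ j, Ω j) {B : Finset I} (hB : B ⊆ touching W S J u)
    (hun : Unlikely P A W c.t (S \ B) (J ∪ W u) (mix J x y)) :
    ‖condMean P (J ∪ W u) (avoidProd A z (S \ B)) (mix J x y)‖ ≤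
      c.ρ * ‖condMean P J (avoidProd A z S) x‖ := by
  set N := touching W S J u with hN
  set G := ‖condMean P J (avoidProd A z (S \ N)) x‖ with hG
  have ha := c.a_nonneg
  have ha1 := c.a_lt_one
  have hρ := c.ρ_nonneg
  have hcard : N.card ≤ d := card_touching_le (hd u) hu J
  have union_eq : N ∪ S \ N = S := Finset.union_sdiff_of_subset (touching_subset S J u)
  have union_eq' : N \ B ∪ S \ N = S \ B := by
    rw [Finset.union_comm]
    exact Finset.sdiff_union_sdiff_cancel (touching_subset S J u) hB
  have dropped : (1 - c.a) ^ N.card * G ≤ ‖condMean P J (avoidProd A z S) x‖ := by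
    have := (norm_condMean_avoidProd_union_mem_Icc hA hW (by rwa [union_eq])
      Finset.disjoint_sdiff (by rwa [union_eq])).1
    rwa [union_eq] at this
  have restored : ‖condMean P (J ∪ W u) (avoidProd A z (S \ B)) (mix J x y)‖ ≤
      (1 + c.a) ^ (N \ B).card * G := by
    have := (norm_condMean_avoidProd_union_mem_Icc hA hW
      (by rw [union_eq']; exact fun S' hS' => hS S' (hS'.trans_subset Finset.sdiff_subset))
      (Finset.disjoint_sdiff.mono_left Finset.sdiff_subset) (by rwa [union_eq'])).2
    rwa [union_eq', hN, condMean_avoidProd_sdiff_touching hW, ← hN, ← hG] at this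
  calc _ ≤ (1 + c.a) ^ (N \ B).card * G := restored
    _ ≤ (1 + c.a) ^ d * G := by
      gcongr
      · linarith
      · exact (Finset.card_le_card Finset.sdiff_subset).trans hcard
    _ ≤ c.ρ * (1 - c.a) ^ d * G := by gcongr; exact c.one_add_pow_le
    _ ≤ c.ρ * ((1 - c.a) ^ N.card * G) := by
      rw [mul_assoc]
      gcongr c.ρ * (?_ * G)
      exact pow_le_pow_of_le_one (by linarith) (by linarith) hcard
    _ ≤ c.ρ * ‖condMean P J (avoidProd A z S) x‖ := by gcongr

include hA hW in
theorem meanNorm_avoidProd_le_sdiff [DecidableEq I] {R : ℝ} (hR : 1 ≤ R) (hz : ‖1 - z‖ ≤ R)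
    {B : Finset I} (hB : B ⊆ S) {V : Set ι} (hV : ∀ k ∈ B, W k ⊆ V) (J : Set ι) (x : ∀ j, Ω j) :
    meanNorm P J V (avoidProd A z S) x ≤
      R ^ B.card * meanNorm P J V (avoidProd A z (S \ B)) x := by
  have bdd (S) := bddMeasurable_condMean P (bddMeasurable_avoidProd hA z S) V
  rw [meanNorm, meanNorm, ← condMean_const_mul]
  refine condMean_mono P (bdd S).norm ((BddMeasurable.const _).mul (bdd (S \ B)).norm) J x
    fun y => ?_
  have factor (w : ∀ j, Ω j) : condMean P V (avoidProd A z S) w =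
      avoidProd A z B w * condMean P V (avoidProd A z (S \ B)) w := by
    simp only [← condMean_mul_left P (dependsOn_avoidProd hW z hV), avoidProd_mul_sdiff z hB]
  rw [factor, norm_mul]
  gcongr
  exact norm_avoidProd_le hR hz B _

include hA hW hd in
/-- The events that have become likely are dropped and their coordinates are revealed as well. -/
theorem meanNorm_union_le_of_not_unlikely [Finite I] (hS : ∀ S' ⊂ S, RevealBounds P A W c S')
    (h : Unlikely P A W c.t S J x) (hu : u ∉ S) {U : Finset I} (hU : Disjoint U S) (y : ∀ j, Ω j)
    (hbad : ¬ Unlikely P A W c.t S (J ∪ W u) (mix J x y)) :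
    meanNorm P (J ∪ W u) (J ∪ W u ∪ ⋃ v ∈ U, W v) (avoidProd A z S) (mix J x y) ≤
      (1 + c.η) ^ U.card * ‖condMean P J (avoidProd A z S) x‖ * c.κ := by
  set J' := J ∪ W u
  set x' := mix J x y
  set F := ‖condMean P J (avoidProd A z S) x‖
  set B := likely P A W c.t S J' x'
  have hη := c.one_le_one_add_η
  classical
  set V := J' ∪ ⋃ v ∈ U ∪ B, W v
  have hBN : B ⊆ touching W S J u := likely_subset_touching hW c.one_le_t h u y
  have hBS : B ⊆ S := hBN.trans (touching_subset S J u)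
  have hBd : B.card ≤ d := (Finset.card_le_card hBN).trans (card_touching_le (hd u) hu J)
  have hss : S \ B ⊂ S := Finset.sdiff_ssubset hBS (likely_nonempty hbad)
  have hdis : Disjoint (U ∪ B) (S \ B) := Finset.disjoint_union_left.2
    ⟨hU.mono_right Finset.sdiff_subset, Finset.disjoint_sdiff⟩
  have hVB (k) (hk : k ∈ B) : W k ⊆ V := Set.subset_union_of_subset_right
    (Set.subset_biUnion_of_mem (u := W) (Finset.mem_coe.2 (Finset.mem_union_right U hk))) _
  calc meanNorm P J' (J' ∪ ⋃ v ∈ U, W v) (avoidProd A z S) x'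
      ≤ meanNorm P J' V (avoidProd A z S) x' :=
        meanNorm_mono P (bddMeasurable_avoidProd hA z S) Set.subset_union_left
          (Set.union_subset_union_right _ (Set.biUnion_subset_biUnion_left
            (Finset.coe_subset.2 Finset.subset_union_left))) x'
    _ ≤ (1 + c.η) ^ B.card * meanNorm P J' V (avoidProd A z (S \ B)) x' :=
        meanNorm_avoidProd_le_sdiff hA hW hη c.norm_one_sub_le hBS hVB J' x'
    _ ≤ (1 + c.η) ^ B.card *
          ((1 + c.η) ^ (U ∪ B).card * ‖condMean P J' (avoidProd A z (S \ B)) x'‖) := by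
        gcongr
        exact (hS _ hss).meanNorm_le unlikely_sdiff_likely hdis
    _ ≤ (1 + c.η) ^ d * ((1 + c.η) ^ (U.card + d) * (c.ρ * F)) := by
        gcongr
        · exact (Finset.card_union_le _ _).trans (Nat.add_le_add_left hBd _)
        · exact norm_condMean_union_avoidProd_sdiff_le hA hW hd hS h hu y hBN
            unlikely_sdiff_likely
    _ = (1 + c.η) ^ U.card * F * ((1 + c.η) ^ (2 * d) * c.ρ) := by ring
    _ ≤ (1 + c.η) ^ U.card * F * c.κ := by gcongr; exact c.pow_mul_ρ_le

include hA hW hd in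
theorem norm_condMean_union_le_of_unlikely [Finite I] (hS : ∀ S' ⊂ S, RevealBounds P A W c S')
    (h : Unlikely P A W c.t S J x) (hu : u ∉ S) (y : ∀ j, Ω j)
    (hgood : Unlikely P A W c.t S (J ∪ W u) (mix J x y)) :
    ‖condMean P (J ∪ W u) (avoidProd A z S) (mix J x y)‖ ≤
      c.ρ * ‖condMean P J (avoidProd A z S) x‖ := by
  classical
  simpa only [Finset.sdiff_empty] using norm_condMean_union_avoidProd_sdiff_le hA hW hd hS h hu y
    (Finset.empty_subset _) (by rwa [Finset.sdiff_empty])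

include hA hW hd in
theorem norm_condMean_union_le [Finite I] (hS : ∀ S' ⊂ S, RevealBounds P A W c S')
    (h : Unlikely P A W c.t S J x) (hu : u ∉ S) (y : ∀ j, Ω j) :
    ‖condMean P (J ∪ W u) (avoidProd A z S) (mix J x y)‖ ≤
      c.κ * ‖condMean P J (avoidProd A z S) x‖ := by
  by_cases hgood : Unlikely P A W c.t S (J ∪ W u) (mix J x y)
  · exact (norm_condMean_union_le_of_unlikely hA hW hd hS h hu y hgood).trans
      (mul_le_mul_of_nonneg_right c.ρ_le_κ (norm_nonneg _))
  · simpa [meanNorm_self, mul_comm] using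
      meanNorm_union_le_of_not_unlikely hA hW hd hS h hu (Finset.disjoint_empty_left S) y hgood

include hA hW hd in
theorem meanNorm_union_le [Finite I] (hS : ∀ S' ⊂ S, RevealBounds P A W c S')
    (h : Unlikely P A W c.t S J x) (hu : u ∉ S) {U : Finset I} (hU : Disjoint U S) (y : ∀ j, Ω j)
    (hind : Unlikely P A W c.t S (J ∪ W u) (mix J x y) →
      meanNorm P (J ∪ W u) (J ∪ W u ∪ ⋃ v ∈ U, W v) (avoidProd A z S) (mix J x y) ≤
        (1 + c.η) ^ U.card * ‖condMean P (J ∪ W u) (avoidProd A z S) (mix J x y)‖) :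
    meanNorm P (J ∪ W u) (J ∪ W u ∪ ⋃ v ∈ U, W v) (avoidProd A z S) (mix J x y) ≤
      (1 + c.η) ^ U.card * ‖condMean P J (avoidProd A z S) x‖ *
        (c.ρ + c.κ * ∑ k ∈ touching W S J u, risk P A W c.t (J ∪ W u) k (mix J x y)) := by
  set F := ‖condMean P J (avoidProd A z S) x‖
  have hη := c.one_le_one_add_η
  have hκ := c.κ_nonneg
  by_cases hgood : Unlikely P A W c.t S (J ∪ W u) (mix J x y)
  · have norm_le := norm_condMean_union_le_of_unlikely hA hW hd hS h hu y hgood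
    have sum_nonneg : 0 ≤ ∑ k ∈ touching W S J u, risk P A W c.t (J ∪ W u) k (mix J x y) :=
      Finset.sum_nonneg fun k _ => risk_nonneg c.t_pos.le _ k _
    calc _ ≤ (1 + c.η) ^ U.card * (c.ρ * F) := (hind hgood).trans (by gcongr)
      _ = (1 + c.η) ^ U.card * F * c.ρ := by ring
      _ ≤ _ := by
        gcongr
        exact le_add_of_nonneg_right (mul_nonneg hκ sum_nonneg)
  · refine (meanNorm_union_le_of_not_unlikely hA hW hd hS h hu hU y hgood).trans ?_
    gcongr
    exact (le_mul_of_one_le_right hκ (one_le_sum_risk_touching hW c.one_le_t h y hgood)).trans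
      (le_add_of_nonneg_left c.ρ_nonneg)

include hA hd in
theorem condMean_sum_risk_touching_le [Finite I] (h : Unlikely P A W c.t S J x) (hu : u ∉ S) :
    condMean P J (fun y => ∑ k ∈ touching W S J u, risk P A W c.t (J ∪ W u) k y) x ≤
      d / c.t := by
  have ht := c.t_pos
  rw [condMean_sum P _ fun k _ => bddMeasurable_risk (hA k) _ _]
  calc _ ≤ ∑ k ∈ touching W S J u, 1 / c.t := by
        refine Finset.sum_le_sum fun k hk => ?_
        obtain ⟨hkS, hk⟩ := mem_touching.1 hk
        have huk : u ≠ k := (ne_of_mem_of_not_mem hkS hu).symm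
        refine (condMean_risk_union_le (hA k) c.one_le_t huk hk x).trans ?_
        gcongr
        exact (h k hkS).le
    _ = (touching W S J u).card / c.t := by rw [Finset.sum_const, nsmul_eq_mul, mul_one_div]
    _ ≤ d / c.t := by
        gcongr
        exact card_touching_le (hd u) hu J

include hA hW hd in
theorem meanNorm_biUnion_le [Finite I] (hS : ∀ S' ⊂ S, RevealBounds P A W c S')
    (h : Unlikely P A W c.t S J x) {U : Finset I} (hU : Disjoint U S) :
    meanNorm P J (J ∪ ⋃ v ∈ U, W v) (avoidProd A z S) x ≤
      (1 + c.η) ^ U.card * ‖condMean P J (avoidProd A z S) x‖ := by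
  classical
  induction U using Finset.induction_on generalizing J x with
  | empty => simp [meanNorm_self]
  | insert u U huU ih =>
    obtain ⟨hu, hU⟩ := Finset.disjoint_insert_left.1 hU
    set F := ‖condMean P J (avoidProd A z S) x‖
    set V := J ∪ W u ∪ ⋃ v ∈ U, W v
    set Q := fun y => ∑ k ∈ touching W S J u, risk P A W c.t (J ∪ W u) k y
    have hη := c.one_le_one_add_η
    have hκ := c.κ_nonneg
    have hbdd := bddMeasurable_avoidProd hA z S
    have hmean : BddMeasurable (meanNorm P (J ∪ W u) V (avoidProd A z S)) :=
      bddMeasurable_condMean P (bddMeasurable_condMean P hbdd V).norm _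
    have hκQ : BddMeasurable fun y => c.κ * Q y :=
      (BddMeasurable.const _).mul (.sum _ fun k _ => bddMeasurable_risk (hA k) _ _)
    have hρκQ := (BddMeasurable.const c.ρ).add hκQ
    rw [Finset.set_biUnion_insert, ← Set.union_assoc,
      ← condMean_meanNorm P hbdd V (Set.subset_union_left : J ⊆ J ∪ W u)]
    calc condMean P J (meanNorm P (J ∪ W u) V (avoidProd A z S)) x
        ≤ condMean P J (fun y => (1 + c.η) ^ U.card * F * (c.ρ + c.κ * Q y)) x :=
          condMean_mono P hmean ((BddMeasurable.const _).mul hρκQ) J x fun y =>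
            meanNorm_union_le hA hW hd hS h hu hU y fun hgood => ih hgood hU
      _ = (1 + c.η) ^ U.card * F * (c.ρ + c.κ * condMean P J Q x) := by
          rw [condMean_const_mul, condMean_add P (.const c.ρ) hκQ, condMean_const,
            condMean_const_mul]
      _ ≤ (1 + c.η) ^ U.card * F * (c.ρ + c.κ * (d / c.t)) := by
          gcongr
          exact condMean_sum_risk_touching_le hA hd h hu
      _ ≤ (1 + c.η) ^ U.card * F * (1 + c.η) :=
          mul_le_mul_of_nonneg_left c.ρ_add_le (by positivity)
      _ = (1 + c.η) ^ (insert u U).card * F := by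
          rw [Finset.card_insert_of_notMem huU, pow_succ]; ring

variable (c S) in
include hA hW hd in
theorem revealBounds [Finite I] : RevealBounds P A W c S := by
  induction S using Finset.strongInduction with
  | H S hS =>
    exact ⟨fun h _ hu y => norm_condMean_union_le hA hW hd hS h hu y,
      fun h _ hU => meanNorm_biUnion_le hA hW hd hS h hU⟩

include hA hW hd in
theorem pow_le_norm_integral_avoidProd [Finite I] (c : RevealConstants d z) (S : Finset I)
    (h : ∀ k ∈ S, c.t ^ revealRank W ∅ k * (Measure.pi P).real (A k) < 1) :
    (1 - c.a) ^ S.card ≤ ‖∫ x, avoidProd A z S x ∂(Measure.pi P)‖ := by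
  classical
  obtain ⟨x⟩ : Nonempty (∀ j, Ω j) := (Measure.pi P).nonempty_of_neZero
  have hunlikely : Unlikely P A W c.t S ∅ x := fun k hk => by
    rw [risk, condProb, condMean_empty, integral_indicator_const _ (hA k), smul_eq_mul, mul_one]
    exact h k hk
  have lower := (norm_condMean_avoidProd_union_mem_Icc (S := ∅) hA hW
    (fun S' _ => revealBounds c S' hA hW hd) (Finset.disjoint_empty_right S)
    (by rwa [Finset.union_empty])).1
  simpa [condMean_empty, avoidProd] using lower

end ZeroFree

theorem one_sub_mul_one_add_pow_le {a : ℝ} (ha : 0 ≤ a) (ha' : 3 * a ≤ 1) (n : ℕ) :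
    (1 - 3 * n * a) * (1 + a) ^ n ≤ (1 - a) ^ n := by
  have bernoulli : 1 + (n : ℝ) * (-(3 * a)) ≤ (1 + -(3 * a)) ^ n :=
    one_add_mul_le_pow (by linarith) n
  calc (1 - 3 * n * a) * (1 + a) ^ n ≤ (1 + -(3 * a)) ^ n * (1 + a) ^ n := by
        gcongr
        linarith
    _ = ((1 - 3 * a) * (1 + a)) ^ n := by rw [← mul_pow, ← sub_eq_add_neg]
    _ ≤ (1 - a) ^ n := pow_le_pow_left₀ (by nlinarith) (by nlinarith) n

section FiveLe

variable {d : ℕ} {z : ℂ} (hd : 5 ≤ d)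

include hd

theorem one_div_natCast_mem_Ioc_of_five_le : 1 / (d : ℝ) ∈ Set.Ioc (0 : ℝ) (1 / 5) :=
  have hd' : (5 : ℝ) ≤ d := by exact_mod_cast hd
  ⟨by positivity, one_div_le_one_div_of_le (by norm_num) hd'⟩

theorem one_add_one_div_cube_pow_le :
    (1 + 1 / (d : ℝ) ^ 3) ^ d ≤ (1 + 4 / (5 * d)) * (1 - 1 / (d : ℝ) ^ 3) ^ d := by
  obtain ⟨hs0, hs⟩ := one_div_natCast_mem_Ioc_of_five_le hd
  have hd0 : (d : ℝ) ≠ 0 := (one_div_pos.1 hs0).ne'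
  have ratio := one_sub_mul_one_add_pow_le (a := (1 / (d : ℝ)) ^ 3) (by positivity)
    (by nlinarith [pow_le_pow_left₀ hs0.le hs 3]) d
  have absorb : 1 ≤ (1 + 4 / 5 * (1 / (d : ℝ))) * (1 - 3 * (1 / (d : ℝ)) ^ 2) := by
    nlinarith [mul_nonneg hs0.le (sub_nonneg.2 hs), mul_nonneg (sq_nonneg (1 / (d : ℝ)))
      (sub_nonneg.2 hs)]
  rw [show (4 : ℝ) / (5 * d) = 4 / 5 * (1 / d) by ring,
    show (1 : ℝ) / (d : ℝ) ^ 3 = (1 / d) ^ 3 by ring]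
  rw [show 3 * (d : ℝ) * (1 / d) ^ 3 = 3 * (1 / d) ^ 2 by field_simp] at ratio
  calc (1 + (1 / (d : ℝ)) ^ 3) ^ d
      ≤ (1 + 4 / 5 * (1 / (d : ℝ))) * (1 - 3 * (1 / (d : ℝ)) ^ 2) *
          (1 + (1 / (d : ℝ)) ^ 3) ^ d := le_mul_of_one_le_left (by positivity) absorb
    _ ≤ (1 + 4 / 5 * (1 / (d : ℝ))) * (1 - (1 / (d : ℝ)) ^ 3) ^ d := by
      rw [mul_assoc]
      gcongr

theorem one_add_one_div_pow_two_mul_mul_le :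
    (1 + 1 / (d : ℝ)) ^ (2 * d) * (1 + 4 / (5 * d)) ≤ 9 := by
  have hs := (one_div_natCast_mem_Ioc_of_five_le hd).2
  calc (1 + 1 / (d : ℝ)) ^ (2 * d) * (1 + 4 / (5 * d))
      = ((1 + 1 / (d : ℝ)) ^ d) ^ 2 * (1 + 4 / 5 * (1 / d)) := by
        rw [mul_comm 2 d, pow_mul]; ring
    _ ≤ 2.7183 ^ 2 * (1 + 4 / 5 * (1 / 5)) := by
        gcongr
        rw [one_div]
        exact Real.one_add_inv_pow_le_exp.trans (by linarith [Real.exp_one_lt_d9])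
    _ ≤ 9 := by norm_num

theorem norm_mul_nine_le (hz : ‖1 - z‖ ≤ 1 + 1 / d) :
    ‖z‖ * 9 ≤ 1 / (d : ℝ) ^ 3 * (3 * d) ^ 3 := by
  obtain ⟨hs0, hs⟩ := one_div_natCast_mem_Ioc_of_five_le hd
  have hd0 : (d : ℝ) ≠ 0 := (one_div_pos.1 hs0).ne'
  have triangle : ‖z‖ ≤ 1 + ‖1 - z‖ := by simpa using norm_sub_le (1 : ℂ) (1 - z)
  calc ‖z‖ * 9 ≤ 27 := by linarith
    _ = _ := by field_simp; norm_num

theorem one_add_add_nine_mul_le :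
    1 + 4 / (5 * d) + 9 * (d / (3 * d) ^ 3) ≤ 1 + 1 / (d : ℝ) := by
  obtain ⟨hs0, hs⟩ := one_div_natCast_mem_Ioc_of_five_le hd
  have hd0 : (d : ℝ) ≠ 0 := (one_div_pos.1 hs0).ne'
  calc 1 + 4 / (5 * d) + 9 * (d / (3 * d) ^ 3)
      = 1 + 4 / 5 * (1 / (d : ℝ)) + 1 / 3 * (1 / d) * (1 / d) := by field_simp; ring
    _ ≤ 1 + 1 / (d : ℝ) := by nlinarith

/-- The constants for events of probability less than `(3 * d) ^ (-3 * rank)`, valid on the disc of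
radius `1 + 1 / d` about `1`. -/
noncomputable def revealConstants (hz : ‖1 - z‖ ≤ 1 + 1 / d) : RevealConstants d z where
  η := 1 / d
  κ := 9
  t := (3 * d) ^ 3
  a := 1 / (d : ℝ) ^ 3
  ρ := 1 + 4 / (5 * d)
  norm_one_sub_le := hz
  η_nonneg := by positivity
  one_le_t := by exact_mod_cast Nat.one_le_pow _ _ (by lia)
  a_nonneg := by positivity
  a_lt_one := by
    rw [div_lt_one (by positivity)]
    exact_mod_cast Nat.one_lt_pow three_ne_zero (by lia)
  one_le_ρ := le_add_of_nonneg_right (by positivity)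
  norm_mul_κ_le := norm_mul_nine_le hd hz
  one_add_pow_le := one_add_one_div_cube_pow_le hd
  pow_mul_ρ_le := one_add_one_div_pow_two_mul_mul_le hd
  ρ_add_le := one_add_add_nine_mul_le hd

end FiveLe

section PowerSums

variable {S : Type*} [CommRing S]

/-- If `e k` are the coefficients of a power series with constant term `1`, then `logPow e k` is
`-k` times the coefficient of `X ^ k` in its logarithm. The recursion is Newton's identities. -/
def logPow (e : ℕ → S) (k : ℕ) : S :=
  -(k : S) * e k - ∑ j : Fin k, logPow e j * e (k - j)
termination_by k
decreasing_by exact j.2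

theorem map_logPow {T : Type*} [CommRing T] (φ : S →+* T) {e : ℕ → S} {e' : ℕ → T}
    (k : ℕ) (h : ∀ j ≤ k, φ (e j) = e' j) : φ (logPow e k) = logPow e' k := by
  induction k using Nat.strong_induction_on with
  | _ k ih =>
    rw [logPow, logPow, map_sub, map_mul, map_neg, map_natCast, h k le_rfl, map_sum]
    congr 1
    refine Finset.sum_congr rfl fun j _ => ?_
    rw [map_mul, ih j j.2 fun i hi => h i (hi.trans j.2.le), h (k - j) (Nat.sub_le _ _)]

theorem totalDegree_logPow_le {σ : Type*} {e : ℕ → MvPolynomial σ S}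
    (he : ∀ k, (e k).totalDegree ≤ 1) (k : ℕ) : (logPow e k).totalDegree ≤ k := by
  induction k using Nat.strong_induction_on with
  | _ k ih =>
    rw [logPow]
    refine (MvPolynomial.totalDegree_sub _ _).trans (max_le ?_ ?_)
    · rcases Nat.eq_zero_or_pos k with rfl | hk
      · simp
      have hC : -(k : MvPolynomial σ S) = MvPolynomial.C (-(k : S)) := by simp
      rw [hC]
      refine (MvPolynomial.totalDegree_mul _ _).trans ?_
      rw [MvPolynomial.totalDegree_C, zero_add]
      exact (he k).trans hk
    · refine MvPolynomial.totalDegree_finsetSum_le fun j _ => ?_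
      calc (logPow e j * e (k - j)).totalDegree
          ≤ (logPow e j).totalDegree + (e (k - j)).totalDegree := MvPolynomial.totalDegree_mul _ _
        _ ≤ j + 1 := add_le_add (ih j j.2) (he _)
        _ ≤ k := j.2

theorem eq_logPow {e p : ℕ → S} (h0 : e 0 = 1)
    (h : ∀ k, ∑ x ∈ Finset.HasAntidiagonal.antidiagonal k, p x.1 * e x.2 = -(k : S) * e k) (k : ℕ) :
    p k = logPow e k := by
  induction k using Nat.strong_induction_on with
  | _ k ih =>
    have newton := h k
    rw [Finset.Nat.sum_antidiagonal_eq_sum_range_succ (fun i j => p i * e j),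
      Finset.sum_range_succ, Nat.sub_self, h0, mul_one, Finset.sum_range] at newton
    have lower : ∑ j : Fin k, logPow e j * e (k - j) = ∑ j : Fin k, p j * e (k - j) :=
      Finset.sum_congr rfl fun j _ => by rw [ih j j.2]
    rw [logPow, lower, ← newton]
    ring

/-- The power series `∑_{k ≥ 1} a ^ k X ^ k`; summed over the reciprocal roots `a` of a polynomial
it is the generating function of their power sums. -/
def geomTail (a : S) : PowerSeries S :=
  PowerSeries.mk fun k => if k = 0 then 0 else a ^ k

theorem one_sub_mul_geomTail (a : S) :
    (1 - PowerSeries.C a * PowerSeries.X) * geomTail a = PowerSeries.C a * PowerSeries.X := by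
  ext k
  rw [sub_mul, one_mul, mul_assoc, map_sub, PowerSeries.coeff_C_mul, PowerSeries.coeff_C_mul]
  rcases k with _ | k
  · simp [geomTail]
  · rw [PowerSeries.coeff_succ_X_mul, PowerSeries.coeff_X]
    rcases k with _ | k
    · simp [geomTail]
    · simp [geomTail, pow_succ']

theorem sum_geomTail_mul_prod_one_sub (s : Multiset S) :
    (s.map geomTail).sum * (s.map fun a => 1 - PowerSeries.C a * PowerSeries.X).prod =
      -(PowerSeries.X * PowerSeries.derivative S
        (s.map fun a => 1 - PowerSeries.C a * PowerSeries.X).prod) := by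
  induction s using Multiset.induction_on with
  | empty => simp
  | cons a s ih =>
    simp only [Multiset.map_cons, Multiset.sum_cons, Multiset.prod_cons, Derivation.leibniz,
      map_sub, smul_eq_mul, PowerSeries.derivative_C, PowerSeries.derivative_X,
      Derivation.map_one_eq_zero]
    linear_combination (1 - PowerSeries.C a * PowerSeries.X) * ih +
      (s.map fun a => 1 - PowerSeries.C a * PowerSeries.X).prod * one_sub_mul_geomTail a

theorem sum_pow_eq_logPow (s : Multiset S) {k : ℕ} (hk : k ≠ 0) :
    (s.map fun a => a ^ k).sum =
      logPow (s.map fun a => 1 - Polynomial.C a * Polynomial.X).prod.coeff k := by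
  set N : Polynomial S := (s.map fun a => 1 - Polynomial.C a * Polynomial.X).prod with hN
  have coe_N : (N : PowerSeries S) =
      (s.map fun a => 1 - PowerSeries.C a * PowerSeries.X).prod := by
    rw [← Polynomial.coeToPowerSeries.ringHom_apply, hN, map_multiset_prod, Multiset.map_map]
    simp [Function.comp_def]
  have N_zero : N.coeff 0 = 1 := by
    rw [Polynomial.coeff_zero_eq_eval_zero, hN, Polynomial.eval_multiset_prod, Multiset.map_map]
    simp
  have coeff_sum : PowerSeries.coeff k (s.map geomTail).sum = logPow N.coeff k := by
    refine eq_logPow (p := fun k => PowerSeries.coeff k (s.map geomTail).sum) N_zero (fun k => ?_) k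
    have newton := congrArg (PowerSeries.coeff k) (sum_geomTail_mul_prod_one_sub s)
    rw [← coe_N, PowerSeries.coeff_mul] at newton
    simp only [Polynomial.coeff_coe] at newton
    rw [newton, map_neg]
    rcases k with _ | k
    · simp
    · rw [PowerSeries.coeff_succ_X_mul, PowerSeries.coeff_derivative, Polynomial.coeff_coe]
      push_cast
      ring
  rw [← coeff_sum, map_multiset_sum, Multiset.map_map]
  refine congrArg Multiset.sum (Multiset.map_congr rfl fun a _ => ?_)
  rw [Function.comp_apply, geomTail, PowerSeries.coeff_mk, if_neg hk]

end PowerSums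

section LogTaylor

open Polynomial

/-- A bound for the error of the Taylor polynomial of degree `K` of `log (1 - w)` for `‖w‖ ≤ b`. -/
noncomputable def logTail (K : ℕ) (b : ℝ) : ℝ := b ^ (K + 1) * (1 - b)⁻¹

theorem logTail_mono (K : ℕ) {a b : ℝ} (ha : 0 ≤ a) (hab : a ≤ b) (hb : b < 1) :
    logTail K a ≤ logTail K b := by
  have ha' : 0 < 1 - a := by linarith
  have hb0 : 0 ≤ b := ha.trans hab
  unfold logTail
  gcongr

theorem logTail_nonneg (K : ℕ) {b : ℝ} (hb0 : 0 ≤ b) (hb1 : b < 1) : 0 ≤ logTail K b :=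
  mul_nonneg (by positivity) (inv_nonneg.2 (sub_nonneg.2 hb1.le))

theorem abs_log_norm_one_sub_add_le {w : ℂ} (hw : ‖w‖ < 1) (K : ℕ) :
    |Real.log ‖1 - w‖ + (∑ k ∈ Finset.range (K + 1), w ^ k / k).re| ≤ logTail K ‖w‖ := by
  have taylor : Complex.logTaylor (K + 1) (-w) = -∑ k ∈ Finset.range (K + 1), w ^ k / k := by
    rw [Complex.logTaylor, ← Finset.sum_neg_distrib]
    refine Finset.sum_congr rfl fun k _ => ?_
    rw [pow_succ, mul_right_comm, ← mul_pow, neg_one_mul, neg_neg, mul_neg_one, neg_div]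
  have remainder := Complex.norm_log_sub_logTaylor_le K (z := -w) (by rwa [norm_neg])
  rw [taylor, sub_neg_eq_add, ← sub_eq_add_neg, norm_neg] at remainder
  rw [← Complex.log_re, ← Complex.add_re]
  exact (Complex.abs_re_le_norm _).trans (remainder.trans
    (div_le_self (logTail_nonneg K (norm_nonneg _) hw) (by simp)))

theorem abs_log_norm_prod_one_sub_add_le {b : ℝ} (hb : b < 1) (K : ℕ) {s : Multiset ℂ}
    (hs : ∀ a ∈ s, ‖a‖ ≤ b) :
    |Real.log ‖(s.map fun a => 1 - a).prod‖ +
      (∑ k ∈ Finset.range (K + 1), (s.map fun a => a ^ k).sum / k).re| ≤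
      s.card * logTail K b := by
  induction s using Multiset.induction_on with
  | empty => simp
  | cons a s ih =>
    have ha := hs a (Multiset.mem_cons_self a s)
    have hs' : ∀ c ∈ s, ‖c‖ ≤ b := fun c hc => hs c (Multiset.mem_cons_of_mem hc)
    have one_sub_ne {c : ℂ} (hc : ‖c‖ ≤ b) : 1 - c ≠ 0 := fun h => by
      rw [← sub_eq_zero.1 h, norm_one] at hc
      exact hb.not_ge hc
    have prod_ne : (s.map fun a => 1 - a).prod ≠ 0 := by
      simpa [Multiset.prod_eq_zero_iff] using fun c hc => one_sub_ne (hs' c hc)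
    have head := (abs_log_norm_one_sub_add_le (ha.trans_lt hb) K).trans
      (logTail_mono K (norm_nonneg a) ha hb)
    simp only [Multiset.map_cons, Multiset.prod_cons, Multiset.sum_cons, norm_mul,
      Multiset.card_cons, add_div, Finset.sum_add_distrib, Complex.add_re, Nat.cast_add_one]
    rw [Real.log_mul (norm_ne_zero_iff.2 (one_sub_ne ha)) (norm_ne_zero_iff.2 prod_ne),
      add_add_add_comm, add_mul, one_mul, add_comm (s.card * _ : ℝ)]
    exact (abs_add_le _ _).trans (add_le_add head (ih hs'))

theorem eq_prod_one_sub_inv_roots {k : Type*} [Field k] [IsAlgClosed k] {N : k[X]}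
    (h0 : N.eval 0 = 1) :
    N = ((N.roots.map fun r => r⁻¹).map fun a => 1 - C a * X).prod := by
  have hN : N ≠ 0 := by rintro rfl; simp at h0
  set M := ((N.roots.map fun r => r⁻¹).map fun a => 1 - C a * X).prod with hM
  have root_ne : ∀ r ∈ N.roots, r ≠ 0 := by
    rintro r hr rfl
    rw [mem_roots hN, IsRoot, h0] at hr
    exact one_ne_zero hr
  have prod_roots : (N.roots.map fun r => X - C r).prod = C (N.roots.map fun r => -r).prod * M := by
    rw [hM, map_multiset_prod, Multiset.map_map, Multiset.map_map, ← Multiset.prod_map_mul]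
    refine congrArg _ (Multiset.map_congr rfl fun r hr => ?_)
    have cancel : C r * C r⁻¹ = (1 : k[X]) := by rw [← C_mul, mul_inv_cancel₀ (root_ne r hr), C_1]
    simp only [Function.comp_apply, C_neg]
    linear_combination (-X) * cancel
  have eq_C_mul : N = C (N.leadingCoeff * (N.roots.map fun r => -r).prod) * M := by
    rw [C_mul, mul_assoc, ← prod_roots]
    exact (IsAlgClosed.splits N).eq_prod_roots
  have M_zero : M.eval 0 = 1 := by
    rw [hM, eval_multiset_prod, Multiset.map_map]
    simp
  have const := congrArg (eval 0) eq_C_mul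
  rw [h0, eval_mul, M_zero, eval_C, mul_one] at const
  rwa [← const, C_1, one_mul] at eq_C_mul

theorem abs_log_norm_eval_add_le {N : ℂ[X]} (h0 : N.eval 0 = 1)
    (hN : ∀ u : ℂ, ‖u‖ ≤ 1 → N.eval u ≠ 0) {w : ℂ} (hw : ‖w‖ < 1) (K : ℕ) :
    |Real.log ‖N.eval w‖ + (∑ k ∈ Finset.range (K + 1), logPow N.coeff k * w ^ k / k).re| ≤
      N.natDegree * logTail K ‖w‖ := by
  have hN0 : N ≠ 0 := by rintro rfl; simp at h0
  obtain ⟨s, hs⟩ : ∃ s, s = N.roots.map fun r => r⁻¹ := ⟨_, rfl⟩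
  have N_eq : N = (s.map fun a => 1 - C a * X).prod := hs ▸ eq_prod_one_sub_inv_roots h0
  have norm_le : ∀ a ∈ s.map fun a => a * w, ‖a‖ ≤ ‖w‖ := by
    simp only [hs, Multiset.map_map, Multiset.mem_map, Function.comp_apply, forall_exists_index,
      and_imp, forall_apply_eq_imp_iff₂]
    intro r hr
    have one_lt : 1 < ‖r‖ := not_le.1 fun h => hN r h ((mem_roots hN0).1 hr)
    rw [norm_mul, norm_inv]
    exact mul_le_of_le_one_left (norm_nonneg w) (inv_le_one_of_one_le₀ one_lt.le)
  have eval_eq : N.eval w = ((s.map fun a => a * w).map fun a => 1 - a).prod := by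
    refine (congrArg (eval w) N_eq).trans ?_
    rw [eval_multiset_prod, Multiset.map_map, Multiset.map_map]
    simp
  have sum_eq : ∑ k ∈ Finset.range (K + 1), logPow N.coeff k * w ^ k / k =
      ∑ k ∈ Finset.range (K + 1), ((s.map fun a => a * w).map fun a => a ^ k).sum / k := by
    refine Finset.sum_congr rfl fun k _ => ?_
    rcases eq_or_ne k 0 with rfl | hk
    · simp
    · simp [sum_pow_eq_logPow s hk, ← N_eq, Multiset.map_map, mul_pow, Multiset.sum_map_mul_right]
  rw [eval_eq, sum_eq]
  refine (abs_log_norm_prod_one_sub_add_le hw K norm_le).trans ?_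
  have := logTail_nonneg K (norm_nonneg w) hw
  gcongr
  rw [Multiset.card_map, hs, Multiset.card_map]
  exact N.card_roots'

end LogTaylor

section Disc

open Polynomial

/-- The pull-back of `(-z) ^ i`, as one summand of a polynomial of degree `n` in `z`, along the
Möbius map `u ↦ (b⁻¹ - b) u / (1 - b u)`, which maps the unit disc onto the disc of radius `b⁻¹`
about `1`, sending `0` to `0` and `b` to `1`. Denominators are cleared by `(1 - b u) ^ n`. -/
noncomputable def discTerm (n : ℕ) (b : ℚ) (i : ℕ) : ℚ[X] :=
  (C (-(b⁻¹ - b)) * X) ^ i * (1 - C b * X) ^ (n - i)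

theorem coeff_discTerm_of_lt (n : ℕ) (b : ℚ) {i k : ℕ} (h : k < i) :
    (discTerm n b i).coeff k = 0 := by
  rw [discTerm, mul_pow, mul_assoc, ← C_pow, coeff_C_mul, coeff_X_pow_mul', if_neg h.not_ge,
    mul_zero]

theorem natDegree_discTerm_le {n : ℕ} (b : ℚ) {i : ℕ} (hi : i ≤ n) :
    (discTerm n b i).natDegree ≤ n := by
  have numerator : (C (-(b⁻¹ - b)) * X : ℚ[X]).natDegree ≤ 1 :=
    (natDegree_C_mul_le _ _).trans natDegree_X_le
  have denominator : (1 - C b * X : ℚ[X]).natDegree ≤ 1 :=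
    (natDegree_sub_le _ _).trans (by simpa using (natDegree_C_mul_le b X).trans natDegree_X_le)
  calc (discTerm n b i).natDegree ≤ i * 1 + (n - i) * 1 :=
        natDegree_mul_le.trans (add_le_add (natDegree_pow_le_of_le i numerator)
          (natDegree_pow_le_of_le (n - i) denominator))
    _ = n := by lia

section Algebra

variable {S : Type*} [CommRing S] [Algebra ℚ S]

/-- The pull-back of `∑ i ≤ n, s i * (-z) ^ i` to the unit disc, see `discTerm`. -/
noncomputable def discPoly (n : ℕ) (b : ℚ) (s : ℕ → S) : S[X] :=
  ∑ i ∈ Finset.range (n + 1), C (s i) * (discTerm n b i).map (algebraMap ℚ S)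

theorem coeff_discPoly (n : ℕ) (b : ℚ) (s : ℕ → S) (k : ℕ) :
    (discPoly n b s).coeff k =
      ∑ i ∈ Finset.range (n + 1), s i * algebraMap ℚ S ((discTerm n b i).coeff k) := by
  simp [discPoly, finsetSum_coeff]

theorem natDegree_discPoly_le (n : ℕ) (b : ℚ) (s : ℕ → S) : (discPoly n b s).natDegree ≤ n :=
  natDegree_sum_le_of_forall_le _ _ fun _ hi => (natDegree_C_mul_le _ _).trans
    (natDegree_map_le.trans (natDegree_discTerm_le b (Finset.mem_range_succ_iff.1 hi)))

theorem map_coeff_discPoly {T : Type*} [CommRing T] [Algebra ℚ T] (φ : S →ₐ[ℚ] T) (n : ℕ) (b : ℚ)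
    {s : ℕ → S} {s' : ℕ → T} {k : ℕ} (h : ∀ i ≤ k, φ (s i) = s' i) :
    φ ((discPoly n b s).coeff k) = (discPoly n b s').coeff k := by
  rw [coeff_discPoly, coeff_discPoly, map_sum]
  refine Finset.sum_congr rfl fun i _ => ?_
  rcases lt_or_ge k i with hki | hik
  · simp [coeff_discTerm_of_lt n b hki]
  · rw [map_mul, AlgHom.commutes, h i hik]

end Algebra

theorem eval_discPoly (n : ℕ) (b : ℚ) (s : ℕ → ℂ) {u : ℂ} (hu : 1 - b * u ≠ 0) :
    (discPoly n b s).eval u = (1 - b * u) ^ n *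
      ∑ i ∈ Finset.range (n + 1), s i * (-(((b : ℂ)⁻¹ - b) * u / (1 - b * u))) ^ i := by
  rw [discPoly, eval_finsetSum, Finset.mul_sum]
  refine Finset.sum_congr rfl fun i hi => ?_
  have split_pow : (1 - (b : ℂ) * u) ^ n = (1 - b * u) ^ (n - i) * (1 - b * u) ^ i := by
    rw [← pow_add, Nat.sub_add_cancel (Finset.mem_range_succ_iff.1 hi)]
  rw [split_pow, ← neg_div, div_pow]
  simp only [discTerm, eval_mul, eval_C, Polynomial.map_mul, Polynomial.map_pow, eval_pow,
    map_C, map_X, eval_X, Polynomial.map_sub, Polynomial.map_one, eval_sub, eval_one, eq_ratCast,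
    Rat.cast_neg, Rat.cast_sub, Rat.cast_inv]
  field_simp

theorem eval_zero_discPoly (n : ℕ) (b : ℚ) (s : ℕ → ℂ) : (discPoly n b s).eval 0 = s 0 := by
  rw [eval_discPoly n b s (by simp)]
  simp [Finset.sum_range_succ']

theorem norm_sub_le_norm_one_sub_mul {b : ℝ} (hb : |b| ≤ 1) {u : ℂ} (hu : ‖u‖ ≤ 1) :
    ‖(b : ℂ) - u‖ ≤ ‖1 - b * u‖ := by
  rw [← sq_le_sq₀ (norm_nonneg _) (norm_nonneg _), ← Complex.normSq_eq_norm_sq,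
    ← Complex.normSq_eq_norm_sq]
  have hb' : b ^ 2 ≤ 1 := (sq_le_one_iff_abs_le_one b).2 hb
  have hu' : Complex.normSq u ≤ 1 := by
    rw [Complex.normSq_eq_norm_sq]
    exact pow_le_one₀ (norm_nonneg _) hu
  simp only [Complex.normSq_apply, Complex.sub_re, Complex.sub_im, Complex.ofReal_re,
    Complex.ofReal_im, Complex.mul_re, Complex.mul_im, Complex.one_re, Complex.one_im] at hu' ⊢
  nlinarith [mul_nonneg (sub_nonneg.2 hu') (sub_nonneg.2 hb')]

section Interior

variable {b : ℚ} (hb0 : 0 < b) (hb1 : b < 1)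

include hb0 hb1

theorem norm_ratCast_lt_one : ‖(b : ℂ)‖ < 1 := by
  rw [Complex.norm_ratCast, abs_of_pos (by exact_mod_cast hb0)]
  exact_mod_cast hb1

theorem one_sub_ratCast_mul_ne_zero {u : ℂ} (hu : ‖u‖ ≤ 1) : 1 - (b : ℂ) * u ≠ 0 := fun h => by
  have hlt := mul_lt_one_of_nonneg_of_lt_one_left (norm_nonneg _) (norm_ratCast_lt_one hb0 hb1) hu
  rw [← norm_mul, ← sub_eq_zero.1 h, norm_one] at hlt
  exact lt_irrefl _ hlt

theorem eval_self_discPoly (n : ℕ) (s : ℕ → ℂ) :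
    (discPoly n b s).eval (b : ℂ) =
      (1 - b * b) ^ n * ∑ i ∈ Finset.range (n + 1), s i * (-1) ^ i := by
  have hbC : (b : ℂ) ≠ 0 := by exact_mod_cast hb0.ne'
  have hne := one_sub_ratCast_mul_ne_zero hb0 hb1 (norm_ratCast_lt_one hb0 hb1).le
  rw [eval_discPoly n b s hne, sub_mul, inv_mul_cancel₀ hbC, div_self hne]

theorem eval_discPoly_ne_zero {n : ℕ} {s : ℕ → ℂ}
    (hG : ∀ z : ℂ, ‖1 - z‖ ≤ (b : ℝ)⁻¹ → ∑ i ∈ Finset.range (n + 1), s i * (-z) ^ i ≠ 0)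
    {u : ℂ} (hu : ‖u‖ ≤ 1) : (discPoly n b s).eval u ≠ 0 := by
  have hbR : (0 : ℝ) < b := by exact_mod_cast hb0
  have hbC : (b : ℂ) ≠ 0 := by exact_mod_cast hb0.ne'
  have hne := one_sub_ratCast_mul_ne_zero hb0 hb1 hu
  rw [eval_discPoly n b s hne]
  refine mul_ne_zero (pow_ne_zero _ hne) (hG _ ?_)
  have moebius : 1 - ((b : ℂ)⁻¹ - b) * u / (1 - b * u) = (b : ℂ)⁻¹ * ((b - u) / (1 - b * u)) := by
    field_simp
    ring
  have contraction : ‖(b : ℂ) - u‖ ≤ ‖1 - b * u‖ := by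
    have hb : |(b : ℝ)| ≤ 1 := by
      rw [abs_of_pos hbR]
      exact_mod_cast hb1.le
    simpa using norm_sub_le_norm_one_sub_mul hb hu
  rw [moebius, norm_mul, norm_inv, Complex.norm_ratCast, abs_of_pos hbR, norm_div]
  exact mul_le_of_le_one_right (by positivity) (div_le_one_of_le₀ contraction (norm_nonneg _))

end Interior

end Disc

section LogTaylorPoly

/-- The variables `σ_1, …, σ_K`, with `σ_0 = 1`, and the junk value `0` in place of the others. -/
noncomputable def sigmaVar (K i : ℕ) : MvPolynomial (Fin K) ℚ :=
  if i = 0 then 1 else if h : i - 1 < K then MvPolynomial.X ⟨i - 1, h⟩ else 0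

/-- The Taylor polynomial of degree `K` at `0` of the logarithm of
`discPoly n b σ / (1 - b u) ^ n`, evaluated at `u = b`, as a polynomial in `σ_1, …, σ_K`. The term
for `k = 0` vanishes because `1 / 0 = 0`. -/
noncomputable def logTaylorPoly (n K : ℕ) (b : ℚ) : MvPolynomial (Fin K) ℚ :=
  ∑ k ∈ Finset.range (K + 1), MvPolynomial.C (b ^ k / k) *
    (MvPolynomial.C (n * b ^ k) - logPow (discPoly n b (sigmaVar K)).coeff k)

theorem totalDegree_sigmaVar_le (K i : ℕ) : (sigmaVar K i).totalDegree ≤ 1 := by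
  unfold sigmaVar
  split_ifs <;> simp

theorem totalDegree_coeff_discPoly_le {σ : Type*} (n : ℕ) (b : ℚ) {s : ℕ → MvPolynomial σ ℚ}
    {d : ℕ} (hs : ∀ i, (s i).totalDegree ≤ d) (k : ℕ) :
    ((discPoly n b s).coeff k).totalDegree ≤ d := by
  rw [coeff_discPoly]
  refine MvPolynomial.totalDegree_finsetSum_le fun i _ => ?_
  refine (MvPolynomial.totalDegree_mul _ _).trans ?_
  rw [MvPolynomial.algebraMap_eq, MvPolynomial.totalDegree_C]
  exact hs i

theorem totalDegree_logTaylorPoly_le (n K : ℕ) (b : ℚ) :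
    (logTaylorPoly n K b).totalDegree ≤ K := by
  refine MvPolynomial.totalDegree_finsetSum_le fun k hk => ?_
  have hlog := totalDegree_logPow_le
    (totalDegree_coeff_discPoly_le n b (totalDegree_sigmaVar_le K)) k
  refine (MvPolynomial.totalDegree_mul _ _).trans ?_
  rw [MvPolynomial.totalDegree_C, zero_add]
  exact (MvPolynomial.totalDegree_sub _ _).trans (max_le
    ((MvPolynomial.totalDegree_C _).trans_le (Nat.zero_le K))
    (hlog.trans (Finset.mem_range_succ_iff.1 hk)))

variable {S : Type*} [CommRing S] [Algebra ℚ S]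

theorem aeval_sigmaVar {K : ℕ} {s : ℕ → S} (hs : s 0 = 1) {i : ℕ} (hi : i ≤ K) :
    MvPolynomial.aeval (fun k : Fin K => s (k + 1)) (sigmaVar K i) = s i := by
  rcases Nat.eq_zero_or_pos i with rfl | hi0
  · simp [sigmaVar, hs]
  · have h : i - 1 < K := by lia
    simp [sigmaVar, hi0.ne', h, Nat.sub_add_cancel hi0]

theorem aeval_logTaylorPoly (n K : ℕ) (b : ℚ) {s : ℕ → S} (hs : s 0 = 1) :
    MvPolynomial.aeval (fun k : Fin K => s (k + 1)) (logTaylorPoly n K b) =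
      ∑ k ∈ Finset.range (K + 1), algebraMap ℚ S (b ^ k / k) *
        (algebraMap ℚ S (n * b ^ k) - logPow (discPoly n b s).coeff k) := by
  set φ : MvPolynomial (Fin K) ℚ →ₐ[ℚ] S := MvPolynomial.aeval fun k : Fin K => s (k + 1)
  rw [logTaylorPoly, map_sum]
  refine Finset.sum_congr rfl fun k hk => ?_
  have hlog : φ (logPow (discPoly n b (sigmaVar K)).coeff k) =
      logPow (discPoly n b s).coeff k :=
    map_logPow (φ : MvPolynomial (Fin K) ℚ →+* S) k fun j hj => map_coeff_discPoly φ n b fun i hi =>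
      aeval_sigmaVar hs (hi.trans (hj.trans (Finset.mem_range_succ_iff.1 hk)))
  rw [map_mul, map_sub, hlog, MvPolynomial.aeval_C, MvPolynomial.aeval_C]

theorem ofReal_aeval_logTaylorPoly (n K : ℕ) (b : ℚ) {s : ℕ → ℝ} (hs : s 0 = 1) :
    ((MvPolynomial.aeval (fun k : Fin K => s (k + 1)) (logTaylorPoly n K b) : ℝ) : ℂ) =
      n * ∑ k ∈ Finset.range (K + 1), ((b : ℂ) * b) ^ k / k -
        ∑ k ∈ Finset.range (K + 1),
          logPow (discPoly n b fun i => (s i : ℂ)).coeff k * (b : ℂ) ^ k / k := by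
  calc _ = MvPolynomial.aeval (fun k : Fin K => (s (k + 1) : ℂ)) (logTaylorPoly n K b) :=
        (MvPolynomial.aeval_algebraMap_apply ℂ (fun k : Fin K => s (k + 1)) _).symm
    _ = _ := aeval_logTaylorPoly n K b (s := fun i => (s i : ℂ)) (by simp [hs])
    _ = _ := by
      rw [Finset.mul_sum, ← Finset.sum_sub_distrib]
      refine Finset.sum_congr rfl fun k _ => ?_
      simp only [eq_ratCast, Rat.cast_div, Rat.cast_pow, Rat.cast_natCast, Rat.cast_mul]
      ring

theorem log_norm_eval_self_discPoly {n : ℕ} {b : ℚ} (hb0 : 0 < b) (hb1 : b < 1) {s : ℕ → ℝ}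
    (hs : ∑ i ∈ Finset.range (n + 1), (s i : ℂ) * (-1) ^ i ≠ 0) :
    Real.log ‖(discPoly n b fun i => (s i : ℂ)).eval (b : ℂ)‖ =
      n * Real.log ‖1 - (b : ℂ) * b‖ +
        Real.log (∑ i ∈ Finset.range (n + 1), s i * (-1) ^ i) := by
  set g := ∑ i ∈ Finset.range (n + 1), s i * (-1) ^ i
  have ofReal_g : (g : ℂ) = ∑ i ∈ Finset.range (n + 1), (s i : ℂ) * (-1) ^ i := by
    push_cast [g]
    rfl
  have hne : ‖1 - (b : ℂ) * b‖ ≠ 0 := norm_ne_zero_iff.2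
    (one_sub_ratCast_mul_ne_zero hb0 hb1 (norm_ratCast_lt_one hb0 hb1).le)
  rw [eval_self_discPoly hb0 hb1, ← ofReal_g, norm_mul, norm_pow,
    Real.log_mul (pow_ne_zero n hne) (norm_ne_zero_iff.2 (ofReal_g ▸ hs)), Real.log_pow,
    Complex.norm_real, Real.norm_eq_abs, Real.log_abs]

theorem abs_log_sub_aeval_logTaylorPoly_le {n : ℕ} (K : ℕ) {b : ℚ} (hb0 : 0 < b) (hb1 : b < 1)
    {s : ℕ → ℝ} (hs : s 0 = 1)
    (hG : ∀ z : ℂ, ‖1 - z‖ ≤ (b : ℝ)⁻¹ → ∑ i ∈ Finset.range (n + 1), (s i : ℂ) * (-z) ^ i ≠ 0) :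
    |Real.log (∑ i ∈ Finset.range (n + 1), s i * (-1) ^ i) -
      MvPolynomial.aeval (fun i : Fin K => s (i + 1)) (logTaylorPoly n K b)| ≤
      2 * n * logTail K b := by
  set N := discPoly n b fun i => (s i : ℂ)
  set g := ∑ i ∈ Finset.range (n + 1), s i * (-1) ^ i with hg
  have hb : (0 : ℝ) < b := by exact_mod_cast hb0
  have norm_b : ‖(b : ℂ)‖ = b := by rw [Complex.norm_ratCast, abs_of_pos hb]
  have hb1' : (b : ℝ) < 1 := norm_b ▸ norm_ratCast_lt_one hb0 hb1
  have norm_bb : ‖(b : ℂ) * b‖ ≤ b := by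
    rw [norm_mul, norm_b]
    exact mul_le_of_le_one_left hb.le hb1'.le
  have numerator := abs_log_norm_eval_add_le (N := N)
    (by rw [eval_zero_discPoly, hs, Complex.ofReal_one])
    (fun u hu => eval_discPoly_ne_zero hb0 hb1 hG hu) (norm_ratCast_lt_one hb0 hb1) K
  have denominator := (abs_log_norm_one_sub_add_le (norm_bb.trans_lt hb1') K).trans
    (logTail_mono K (norm_nonneg _) norm_bb hb1')
  rw [log_norm_eval_self_discPoly hb0 hb1 (hG 1 (by simpa using hb.le)), ← hg, norm_b] at numerator
  set T := (∑ k ∈ Finset.range (K + 1), logPow N.coeff k * (b : ℂ) ^ k / k).re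
  set T' := (∑ k ∈ Finset.range (K + 1), ((b : ℂ) * b) ^ k / k).re
  have aeval_eq : MvPolynomial.aeval (fun i : Fin K => s (i + 1)) (logTaylorPoly n K b) =
      n * T' - T := by
    rw [← Complex.ofReal_re (MvPolynomial.aeval _ _), ofReal_aeval_logTaylorPoly n K b hs,
      Complex.sub_re, ← Complex.ofReal_natCast, Complex.re_ofReal_mul]
  calc |Real.log g - MvPolynomial.aeval (fun i : Fin K => s (i + 1)) (logTaylorPoly n K b)|
      = |(n * Real.log ‖1 - (b : ℂ) * b‖ + Real.log g + T) -
          n * (Real.log ‖1 - (b : ℂ) * b‖ + T')| := by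
        rw [aeval_eq]
        ring_nf
    _ ≤ N.natDegree * logTail K b + n * logTail K b := by
        refine (abs_sub _ _).trans (add_le_add numerator ?_)
        rw [abs_mul, Nat.abs_cast]
        gcongr
    _ ≤ n * logTail K b + n * logTail K b := by
        have := logTail_nonneg K hb.le hb1'
        gcongr
        exact natDegree_discPoly_le n b _
    _ = 2 * n * logTail K b := by ring

end LogTaylorPoly

section Expansion

variable {X : Type*}

theorem avoidProd_eq_sum_indicator {I : Type*} (A : I → Set X) (z : ℂ) (S : Finset I) (x : X) :
    avoidProd A z S x =
      ∑ s ∈ S.powerset, (⋂ i ∈ s, A i).indicator (fun _ => (-z) ^ s.card) x := by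
  classical
  have factor (i : I) : 1 - z * (A i).indicator (fun _ => (1 : ℂ)) x =
      (A i).indicator (fun _ => -z) x + 1 := by
    by_cases hx : x ∈ A i <;> simp [hx, sub_eq_neg_add]
  rw [avoidProd, Finset.prod_congr rfl fun i _ => factor i, Finset.prod_add_one]
  refine Finset.sum_congr rfl fun s _ => ?_
  by_cases hx : ∀ i ∈ s, x ∈ A i
  · rw [Set.indicator_of_mem (Set.mem_iInter₂.2 hx), ← Finset.prod_const]
    exact Finset.prod_congr rfl fun i hi => Set.indicator_of_mem (hx i hi) _
  · rw [Set.indicator_of_notMem (mt Set.mem_iInter₂.1 hx)]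
    obtain ⟨i, hi, hxi⟩ := not_forall₂.1 hx
    exact Finset.prod_eq_zero hi (Set.indicator_of_notMem hxi _)

theorem avoidProd_one_eq_indicator {I : Type*} [Fintype I] (A : I → Set X) (x : X) :
    avoidProd A 1 Finset.univ x = (⋂ i, (A i)ᶜ).indicator (fun _ => (1 : ℂ)) x := by
  by_cases hx : ∀ i, x ∉ A i
  · rw [Set.indicator_of_mem (Set.mem_iInter.2 hx)]
    simp [avoidProd, hx]
  · rw [Set.indicator_of_notMem (mt Set.mem_iInter.1 hx)]
    obtain ⟨i, hi⟩ := not_forall_not.1 hx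
    exact Finset.prod_eq_zero (Finset.mem_univ i) (by simp [hi])

variable [MeasurableSpace X] (μ : Measure X) [IsFiniteMeasure μ]

theorem integral_avoidProd_eq_sum {n : ℕ} {A : Fin n → Set X} (hA : ∀ i, MeasurableSet (A i))
    (z : ℂ) :
    ∫ x, avoidProd A z Finset.univ x ∂μ =
      ∑ k ∈ Finset.range (n + 1), (intersectionSum μ A k : ℂ) * (-z) ^ k := by
  have measurable_inter (s : Finset (Fin n)) : MeasurableSet (⋂ i ∈ s, A i) :=
    Finset.measurableSet_biInter s fun i _ => hA i
  simp only [avoidProd_eq_sum_indicator]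
  rw [integral_finsetSum _ fun s _ => (integrable_const _).indicator (measurable_inter s)]
  simp only [integral_indicator_const _ (measurable_inter _)]
  rw [Finset.sum_powerset, Finset.card_univ, Fintype.card_fin]
  refine Finset.sum_congr rfl fun k _ => ?_
  rw [intersectionSum, Complex.ofReal_sum, Finset.sum_mul]
  refine Finset.sum_congr rfl fun s hs => ?_
  rw [(Finset.mem_powersetCard.1 hs).2, Complex.real_smul]

omit [IsFiniteMeasure μ] in
theorem integral_avoidProd_one {I : Type*} [Fintype I] {A : I → Set X}
    (hA : ∀ i, MeasurableSet (A i)) :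
    ∫ x, avoidProd A 1 Finset.univ x ∂μ = (μ.real (⋂ i, (A i)ᶜ) : ℂ) := by
  simp only [avoidProd_one_eq_indicator]
  rw [integral_indicator_const _ (MeasurableSet.iInter fun i => (hA i).compl), Complex.real_smul,
    mul_one]

theorem measureReal_iInter_compl_eq_sum {n : ℕ} {A : Fin n → Set X}
    (hA : ∀ i, MeasurableSet (A i)) :
    μ.real (⋂ i, (A i)ᶜ) = ∑ k ∈ Finset.range (n + 1), intersectionSum μ A k * (-1) ^ k := by
  have := (integral_avoidProd_one μ hA).symm.trans (integral_avoidProd_eq_sum μ hA 1)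
  exact_mod_cast this

omit [IsFiniteMeasure μ] in
theorem intersectionSum_zero [IsProbabilityMeasure μ] {n : ℕ} (A : Fin n → Set X) :
    intersectionSum μ A 0 = 1 := by
  simp [intersectionSum]

end Expansion

section Truncation

theorem logTail_le_exp_div (K : ℕ) {b : ℝ} (hb0 : 0 ≤ b) (hb1 : b < 1) :
    logTail K b ≤ Real.exp (-((1 - b) * (K + 1))) / (1 - b) := by
  have hb : b ≤ Real.exp (-(1 - b)) := by linarith [Real.add_one_le_exp (-(1 - b))]
  have : 0 < 1 - b := sub_pos.2 hb1
  calc logTail K b ≤ Real.exp (-(1 - b)) ^ (K + 1) * (1 - b)⁻¹ := by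
        unfold logTail
        gcongr
    _ = Real.exp (-((1 - b) * (K + 1))) / (1 - b) := by
        rw [← Real.exp_nat_mul, div_eq_mul_inv]
        push_cast
        ring_nf

theorem add_one_mul_log_add_le {d L : ℝ} (hd : 2 ≤ d) (hL : 1 / 2 ≤ L) :
    (d + 1) * (Real.log (4 * (d + 1)) + L) ≤ Real.exp (20 * d) * L := by
  have hlog : Real.log (4 * (d + 1)) ≤ 4 * (d + 1) := Real.log_le_self (by positivity)
  calc (d + 1) * (Real.log (4 * (d + 1)) + L) ≤ (d + 1) * (4 * (d + 1) * (2 * L) + L) := by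
        gcongr
        nlinarith
    _ = (d + 1) * (8 * d + 9) * L := by ring
    _ ≤ Real.exp (5 * d) * Real.exp (15 * d) * L := by
        gcongr
        · linarith [Real.add_one_le_exp (5 * d)]
        · linarith [Real.add_one_le_exp (15 * d)]
    _ = Real.exp (20 * d) * L := by
        rw [← Real.exp_add]
        ring_nf

theorem half_le_log_of_two_le {x : ℝ} (hx : 2 ≤ x) : 1 / 2 ≤ Real.log x := by
  linarith [Real.log_le_log two_pos hx, Real.log_two_gt_d9]

theorem two_mul_mul_logTail_le {d n ε : ℝ} {K : ℕ} (hd : 2 ≤ d) (hn : 0 < n) (hε : 0 < ε)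
    (hnε : 2 ≤ n / ε) (hK : Real.exp (20 * d) * Real.log (n / ε) ≤ K + 1) :
    2 * n * logTail K (d / (d + 1)) ≤ ε / 2 := by
  have gap : 1 - d / (d + 1) = 1 / (d + 1) := by field_simp; ring
  have large : Real.log (4 * (d + 1) * (n / ε)) ≤ 1 / (d + 1) * (K + 1) := by
    rw [Real.log_mul (by positivity) (by positivity), one_div, le_inv_mul_iff₀ (by positivity)]
    exact (add_one_mul_log_add_le hd (half_le_log_of_two_le hnε)).trans hK
  calc 2 * n * logTail K (d / (d + 1))
      ≤ 2 * n * (Real.exp (-(1 / (d + 1) * (K + 1))) / (1 / (d + 1))) := by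
        gcongr
        rw [← gap]
        exact logTail_le_exp_div K (by positivity) ((div_lt_one (by positivity)).2 (lt_add_one d))
    _ ≤ 2 * n * (Real.exp (-Real.log (4 * (d + 1) * (n / ε))) / (1 / (d + 1))) := by gcongr
    _ = ε / 2 := by
        rw [Real.exp_neg, Real.exp_log (by positivity)]
        field_simp
        ring

/-- The number `K` of sums `σ_k` used for degree `d` and `x = n / ε`. For `x < 2` there is a single
event, of small probability, and none are needed. -/
noncomputable def truncationOrder (d x : ℝ) : ℕ :=
  if 2 ≤ x then ⌊Real.exp (20 * d) * Real.log x⌋₊ else 0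

theorem truncationOrder_le (d : ℝ) {x : ℝ} (hx : 1 ≤ x) :
    truncationOrder d x ≤ Real.exp (20 * d) * Real.log x := by
  have : 0 ≤ Real.exp (20 * d) * Real.log x :=
    mul_nonneg (Real.exp_pos _).le (Real.log_nonneg hx)
  unfold truncationOrder
  split_ifs
  · exact Nat.floor_le this
  · exact_mod_cast this

theorem le_truncationOrder_add_one (d : ℝ) {x : ℝ} (hx : 2 ≤ x) :
    Real.exp (20 * d) * Real.log x ≤ truncationOrder d x + 1 := by
  rw [truncationOrder, if_pos hx]
  exact (Nat.lt_floor_add_one _).le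

theorem logTaylorPoly_zero (n : ℕ) (b : ℚ) : logTaylorPoly n 0 b = 0 := by
  simp [logTaylorPoly]

theorem abs_log_le_of_four_fifths_le {p : ℝ} (hp : 4 / 5 ≤ p) (hp1 : p ≤ 1) :
    |Real.log p| ≤ 1 / 4 := by
  have hp0 : 0 < p := by linarith
  have hinv : p⁻¹ ≤ 5 / 4 := by
    rw [inv_le_comm₀ hp0 (by norm_num)]
    linarith
  rw [abs_of_nonpos (Real.log_nonpos hp0.le hp1)]
  linarith [Real.one_sub_inv_le_log_of_pos hp0]

theorem abs_exp_sub_le_of_abs_log_sub_le {p q ε : ℝ} (hp : 0 < p) (hε : ε ≤ 2)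
    (h : |Real.log p - q| ≤ ε / 2) : |Real.exp q - p| ≤ ε * p := by
  rw [abs_sub_comm] at h
  have relative : |Real.exp (q - Real.log p) - 1| ≤ ε :=
    (Real.abs_exp_sub_one_le (by linarith)).trans (by linarith)
  calc |Real.exp q - p| = |(Real.exp (q - Real.log p) - 1) * p| := by
        rw [Real.exp_sub, Real.exp_log hp, sub_mul, one_mul, div_mul_cancel₀ _ hp.ne']
    _ ≤ ε * p := by
        rw [abs_mul, abs_of_pos hp]
        gcongr

end Truncation

section LocalLemma

variable {ι I : Type*} [Fintype ι] {Ω : ι → Type*} [∀ j, MeasurableSpace (Ω j)]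

/-- The hypotheses of the local lemma for events `A k` that depend on the coordinates `W k` only;
`revealRank W ∅ k` is the exponent `μ_k`. -/
structure LocalLemmaCondition (P : ∀ j, Measure (Ω j)) (A : I → Set (∀ j, Ω j)) (W : I → Set ι)
    (d : ℕ) : Prop where
  five_le : 5 ≤ d
  measurableSet (k : I) : MeasurableSet (A k)
  dependsOn (k : I) : DependsOn (fun x => x ∈ A k) (W k)
  ncard_neighbors_le (u : I) : {k | k ≠ u ∧ (W k ∩ W u).Nonempty}.ncard ≤ d
  pow_mul_measureReal_lt_one (k : I) :
    ((3 * (d : ℝ)) ^ 3) ^ revealRank W ∅ k * (Measure.pi P).real (A k) < 1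

namespace LocalLemmaCondition

variable {P : ∀ j, Measure (Ω j)} [∀ j, IsProbabilityMeasure (P j)] {W : I → Set ι} {d : ℕ}

theorem pow_le_norm_integral_avoidProd [Finite I] {A : I → Set (∀ j, Ω j)}
    (h : LocalLemmaCondition P A W d) {z : ℂ} (hz : ‖1 - z‖ ≤ 1 + 1 / d) (S : Finset I) :
    (1 - 1 / (d : ℝ) ^ 3) ^ S.card ≤ ‖∫ x, avoidProd A z S x ∂Measure.pi P‖ :=
  _root_.pow_le_norm_integral_avoidProd h.measurableSet h.dependsOn h.ncard_neighbors_le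
    (revealConstants h.five_le hz) S fun k _ => h.pow_mul_measureReal_lt_one k

theorem pow_le_measureReal [Fintype I] {A : I → Set (∀ j, Ω j)}
    (h : LocalLemmaCondition P A W d) :
    (1 - 1 / (d : ℝ) ^ 3) ^ Fintype.card I ≤ (Measure.pi P).real (⋂ i, (A i)ᶜ) := by
  have := h.pow_le_norm_integral_avoidProd (z := 1) (by rw [sub_self, norm_zero]; positivity)
    Finset.univ
  rwa [integral_avoidProd_one _ h.measurableSet, Complex.norm_real,
    Real.norm_of_nonneg measureReal_nonneg] at this

omit [∀ j, IsProbabilityMeasure (P j)] in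
theorem one_sub_pos {A : I → Set (∀ j, Ω j)} (h : LocalLemmaCondition P A W d) :
    0 < 1 - 1 / (d : ℝ) ^ 3 :=
  by
  have : (1 : ℝ) < d := by exact_mod_cast h.five_le.trans_lt' (by norm_num)
  exact sub_pos.2 ((div_lt_one (by positivity)).2 (one_lt_pow₀ this three_ne_zero))

theorem measureReal_pos [Finite I] {A : I → Set (∀ j, Ω j)}
    (h : LocalLemmaCondition P A W d) : 0 < (Measure.pi P).real (⋂ i, (A i)ᶜ) := by
  cases nonempty_fintype I
  exact (pow_pos h.one_sub_pos _).trans_le h.pow_le_measureReal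

variable {n : ℕ} {A : Fin n → Set (∀ j, Ω j)} {V : Fin n → Set ι}
  (h : LocalLemmaCondition P A V d)

include h

theorem sum_intersectionSum_ne_zero {z : ℂ} (hz : ‖1 - z‖ ≤ 1 + 1 / d) :
    ∑ k ∈ Finset.range (n + 1), (intersectionSum (Measure.pi P) A k : ℂ) * (-z) ^ k ≠ 0 := by
  rw [← integral_avoidProd_eq_sum _ h.measurableSet]
  exact norm_pos_iff.1
    ((pow_pos h.one_sub_pos _).trans_le (h.pow_le_norm_integral_avoidProd hz Finset.univ))

theorem abs_log_sub_aeval_logTaylorPoly_le (K : ℕ) :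
    |Real.log ((Measure.pi P).real (⋂ i, (A i)ᶜ)) -
      MvPolynomial.aeval (fun k : Fin K => intersectionSum (Measure.pi P) A (k + 1))
        (logTaylorPoly n K (d / (d + 1)))| ≤ 2 * n * logTail K (d / (d + 1)) := by
  have hd : 0 < d := by linarith [h.five_le]
  have hb0 : (0 : ℚ) < d / (d + 1) := by positivity
  have hb1 : (d / (d + 1) : ℚ) < 1 := (div_lt_one (by positivity)).2 (lt_add_one _)
  have cast_b : ((d / (d + 1) : ℚ) : ℝ) = d / (d + 1) := by push_cast; rfl
  have radius : (d / (d + 1) : ℝ)⁻¹ = 1 + 1 / d := by field_simp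
  rw [measureReal_iInter_compl_eq_sum _ h.measurableSet]
  simpa only [cast_b] using _root_.abs_log_sub_aeval_logTaylorPoly_le K hb0 hb1
    (intersectionSum_zero (Measure.pi P) A)
    fun z hz => h.sum_intersectionSum_ne_zero (hz.trans_eq (by rw [cast_b, radius]))

theorem abs_log_measureReal_le (hn : n ≤ 1) :
    |Real.log ((Measure.pi P).real (⋂ i, (A i)ᶜ))| ≤ 1 / 4 := by
  refine abs_log_le_of_four_fifths_le ?_ measureReal_le_one
  have hd : (5 : ℝ) ≤ d := by exact_mod_cast h.five_le
  calc 4 / 5 ≤ 1 - 1 / (d : ℝ) ^ 3 := by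
        have : 1 / (d : ℝ) ^ 3 ≤ 1 / 5 := one_div_le_one_div_of_le (by norm_num)
          (hd.trans (le_self_pow₀ (by linarith) three_ne_zero))
        linarith
    _ ≤ (1 - 1 / (d : ℝ) ^ 3) ^ n := by
        simpa only [pow_one] using
          pow_le_pow_of_le_one h.one_sub_pos.le (sub_le_self _ (by positivity)) hn
    _ ≤ (Measure.pi P).real (⋂ i, (A i)ᶜ) := by simpa using h.pow_le_measureReal

theorem abs_log_sub_aeval_logTaylorPoly_truncationOrder_le (hn : 0 < n) {ε : ℝ} (hε : 0 < ε)
    (hε1 : ε ≤ 1) :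
    |Real.log ((Measure.pi P).real (⋂ i, (A i)ᶜ)) -
      MvPolynomial.aeval
        (fun k : Fin (truncationOrder d (n / ε)) => intersectionSum (Measure.pi P) A (k + 1))
        (logTaylorPoly n (truncationOrder d (n / ε)) (d / (d + 1)))| ≤ ε / 2 := by
  have hd : (5 : ℝ) ≤ d := by exact_mod_cast h.five_le
  rcases le_or_gt 2 (n / ε) with many | few
  · exact (h.abs_log_sub_aeval_logTaylorPoly_le _).trans (two_mul_mul_logTail_le (by linarith)
      (by positivity) hε many (le_truncationOrder_add_one d many))
  · have n_lt : n < 2 * ε := (div_lt_iff₀ hε).1 few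
    have n_lt_two : (n : ℝ) < 2 := by linarith
    have n_le_one : n ≤ 1 := Nat.lt_succ_iff.1 (by exact_mod_cast n_lt_two)
    have half_lt : 1 / 2 < ε := by
      have : (1 : ℝ) ≤ n := by exact_mod_cast hn
      linarith
    rw [truncationOrder, if_neg few.not_ge, logTaylorPoly_zero, map_zero, sub_zero]
    exact (h.abs_log_measureReal_le n_le_one).trans (by linarith)

end LocalLemmaCondition

theorem mul_lt_one_of_lt_zpow {d q : ℝ} (hd : 1 ≤ d) (hq : 0 ≤ q) {k l : ℕ} (hkl : k ≤ l)
    (h : q < (3 * d) ^ (-(3 * (l : ℤ)))) : ((3 * d) ^ 3) ^ k * q < 1 := by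
  have zpow_eq : (3 * d) ^ (-(3 * (l : ℤ))) = (((3 * d) ^ 3) ^ l)⁻¹ := by
    rw [zpow_neg, zpow_mul, zpow_natCast]
    norm_cast
  calc ((3 * d) ^ 3) ^ k * q ≤ ((3 * d) ^ 3) ^ l * q := by
        gcongr
        exact one_le_pow₀ (by linarith)
    _ < 1 := by
        rwa [mul_comm, ← lt_div_iff₀ (by positivity), one_div, ← zpow_eq]

theorem dependsOn_eventCoords {m : ℕ} {Ω : Fin m → Type*} (A : Set (∀ j, Ω j)) :
    DependsOn (fun x => x ∈ A) (eventCoords A) := by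
  intro x y hxy
  have indicator_eq : A.indicator (fun _ => (1 : ℂ)) x = A.indicator (fun _ => (1 : ℂ)) y :=
    dependsOn_coordSet (A.indicator fun _ => (1 : ℂ)) hxy
  by_cases hx : x ∈ A <;> by_cases hy : y ∈ A <;> simp [hx, hy] at indicator_eq ⊢

theorem localLemmaCondition_eventCoords {m n d : ℕ} {Ω : Fin m → Type*}
    [∀ j, MeasurableSpace (Ω j)] {P : ∀ j, Measure (Ω j)} {A : Fin n → Set (∀ j, Ω j)}
    {r D : Fin n → ℕ} (hd : 5 ≤ d) (hA : ∀ i, MeasurableSet (A i))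
    (hr : ∀ i, (eventCoords (A i)).ncard ≤ r i)
    (hD : ∀ i, {j : Fin n | j ≠ i ∧ ShareCoordinate (A j) (A i)}.ncard ≤ D i)
    (hDd : ∀ i, D i ≤ d)
    (hp : ∀ i, (Measure.pi P).real (A i) <
      (3 * (d : ℝ)) ^ (-(3 * ((min (r i) (D i + 1) : ℕ) : ℤ)))) :
    LocalLemmaCondition P A (fun i => eventCoords (A i)) d where
  five_le := hd
  measurableSet := hA
  dependsOn i := dependsOn_eventCoords (A i)
  ncard_neighbors_le i := (hD i).trans (hDd i)
  pow_mul_measureReal_lt_one i := by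
    refine mul_lt_one_of_lt_zpow (by exact_mod_cast hd.trans' (by norm_num)) measureReal_nonneg
      (min_le_min ?_ ?_) (hp i)
    · simpa using hr i
    · simpa [ShareCoordinate, Set.subset_empty_iff, ← Set.nonempty_iff_ne_empty] using hD i

end LocalLemma

/-- The polynomial `Q` in `K` variables is evaluated at `(σ_1, …, σ_K)`; `C` is the absolute
constant in `K = e^{O(Δ)} ln (n / ε)`. -/
theorem theorem1p2 :
    ∃ C : ℝ, ∀ Δ n : ℕ, 5 ≤ Δ → 1 ≤ n → ∀ ε : ℝ, 0 < ε → ε < 1 →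
      ∃ K : ℕ, (K : ℝ) ≤ Real.exp (C * (Δ : ℝ)) * Real.log ((n : ℝ) / ε) ∧
      ∃ Q : MvPolynomial (Fin K) ℚ, Q.totalDegree ≤ K ∧
        ∀ (m : ℕ) (Ω : Fin m → Type u) [∀ j, MeasurableSpace (Ω j)]
          (P : ∀ j, Measure (Ω j)) [∀ j, IsProbabilityMeasure (P j)]
          (A : Fin n → Set (∀ j, Ω j)) (r D : Fin n → ℕ),
          (∀ i, MeasurableSet (A i)) →
          (∀ i, (eventCoords (A i)).ncard ≤ r i) →
          (∀ i, {j : Fin n | j ≠ i ∧ ShareCoordinate (A j) (A i)}.ncard ≤ D i) →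
          Δ = max 5 (Finset.univ.sup D) →
          (∀ i, (Measure.pi P).real (A i) <
            (3 * (Δ : ℝ)) ^ (-(3 * ((min (r i) (D i + 1) : ℕ) : ℤ)))) →
          0 < (Measure.pi P).real (⋂ i, (A i)ᶜ) ∧
          |Real.log ((Measure.pi P).real (⋂ i, (A i)ᶜ)) -
            MvPolynomial.aeval
              (fun k : Fin K => intersectionSum (Measure.pi P) A ((k : ℕ) + 1)) Q| ≤ ε ∧
          |Real.exp (MvPolynomial.aeval
              (fun k : Fin K => intersectionSum (Measure.pi P) A ((k : ℕ) + 1)) Q) -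
            (Measure.pi P).real (⋂ i, (A i)ᶜ)| ≤
              ε * (Measure.pi P).real (⋂ i, (A i)ᶜ) := by
  refine ⟨20, fun d n hd hn ε hε hε1 => ?_⟩
  have hnε : 1 ≤ (n : ℝ) / ε := (one_le_div hε).2 (hε1.le.trans (by exact_mod_cast hn))
  refine ⟨truncationOrder d (n / ε), truncationOrder_le d hnε,
    logTaylorPoly n (truncationOrder d (n / ε)) (d / (d + 1)),
    totalDegree_logTaylorPoly_le n _ _, ?_⟩
  intro m Ω _ P _ A r D hA hr hD hΔ hp
  have hDd (i : Fin n) : D i ≤ d :=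
    hΔ ▸ (Finset.le_sup (Finset.mem_univ i)).trans (le_max_right _ _)
  have condition := localLemmaCondition_eventCoords hd hA hr hD hDd hp
  have log_bound := condition.abs_log_sub_aeval_logTaylorPoly_truncationOrder_le hn hε hε1.le
  exact ⟨condition.measureReal_pos, log_bound.trans (half_le_self hε.le),
    abs_exp_sub_le_of_abs_log_sub_le condition.measureReal_pos (by linarith) log_bound⟩
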